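/- **Setting.** Let $D=(-1,1)$ and $\Lambda=(-1,1)$. For a Banach space $X$, $H^1(\Lambda;X)$ denotes the Bochner–Sobolev space of all $u\in L^2(\Lambda;X)$ with a weak derivative in $L^2(\Lambda;X)$. The total cross section $\Sigma_t(x,\mu)$ and the nonnegative scattering cross section $\Sigma_s(x,\nu,\mu)\ge 0$ satisfy $\Sigma_t\in C(\Lambda;L^\infty(D))$ and $\Sigma_s\in H^1(\Lambda_\nu;H^1(\Lambda_\mu;L^\infty(D)))$, where $\Lambda_\nu=\Lambda_\mu=\Lambda$; for $\Sigma_s$ the representative that is continuous in $(\nu,\mu)\in\Lambda\times\Lambda$ with values in $L^\infty(D)$ is taken. Assume that there is a constant $c>0$ such that $$\Sigma_t(x,\mu)-\tfrac12\int_\Lambda\Sigma_s(x,\nu,\mu)\,d\nu\ \ge\ c\quad\text{and}\quad \Sigma_t(x,\nu)-\tfrac12\int_\Lambda\Sigma_s(x,\nu,\mu)\,d\mu\ \ge\ c ,$$ for every $\mu\in\Lambda$, respectively every $\nu\in\Lambda$, and almost every $x\in D$. **Scheme.** For $M\ge 0$ let $\mu_0<\dots<\mu_M$ be the zeros of the Legendre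 polynomial $L_{M+1}$, $\nu_i=\mu_i$, and $\omega_i=\dfrac{2}{(1-\mu_i^2)\,[L_{M+1}'(\mu_i)]^2}$. Let $P_N(D)$ be the polynomials of degree at most $N$ on $D$, let $W_N^M=P_M(\Lambda;P_N(D))$ be the polynomials in $\mu$ of degree at most $M$ with values in $P_N(D)$, and let $P_N^m(D)$ be the set of $v\in P_N(D)$ with $v(-1)=0$ if $\mu_m>0$, with $v(1)=0$ if $\mu_m<0$, and without further condition if $\mu_m=0$. Put $\mathring W_N^M=\{u\in W_N^M: u(\cdot,\mu_m)\in P_N^m(D),\ m=0,\dots,M\}$ and $$(\mathcal L_M\varphi)(x,\mu)=\mu\,\partial_x\varphi(x,\mu)+\Sigma_t(x,\mu)\varphi(x,\mu)-\tfrac12\sum_{i=0}^M\omega_i\,\Sigma_s(x,\nu_i,\mu)\,\varphi(x,\nu_i).$$ Let $(u,v)=\int_D uv\,dx$, $\langle u,v\rangle_M=\sum_{m=0}^M\omega_m\,(u(\cdot,\mu_m),v(\cdot,\mu_m))$ and $|||u|||^2=\int_\Lambda\int_D u^2\,dx\,d\mu$. Given a source $s$ with $s(\cdot,\mu)\in L^2(D)$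 for every $\mu$, and inflow data $g_l,g_r$, the discrete problem is to find $\varphi\in W_N^M$ such that $$\big((\mathcal L_M\varphi)(\cdot,\mu_m),v\big)=\tfrac12\,\big(s(\cdot,\mu_m),v\big)\qquad\text{for all } v\in P_N^m(D),\ m=0,\dots,M,\tag{P}$$ $$\varphi(-1,\mu_m)=g_l(\mu_m)\ \text{ if }\mu_m>0,\qquad \varphi(1,\mu_m)=g_r(\mu_m)\ \text{ if }\mu_m<0 .$$ **Theorem 3.1.** There is an $M_0$, depending only on $\Sigma_t$, $\Sigma_s$ and $c$, such that for all $M\ge M_0$ and all $N\ge 0$: 1. for all $s,g_l,g_r$ as above, the discrete problem (P) has a unique solution $\varphi\in W_N^M$; 2. for every $\varphi\in\mathring W_N^M$ (vacuum boundary conditions), $$\langle\mathcal L_M\varphi,\varphi\rangle_M\ \ge\ \frac c2\,|||\varphi|||^2+\frac12\sum_{m=0}^M\omega_m|\mu_m|\,\varphi(\operatorname{sign}\mu_m,\mu_m)^2 ,\qquad \operatorname{sign}0=0 .$$ -/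

import Mathlib

open MeasureTheory Set Polynomial
open scoped ENNReal ContDiff Polynomial.Bivariate

namespace NeutronTransport

noncomputable section

/-! ### The domains and Lebesgue spaces on them -/

/-- The spatial domain `D = (-1, 1)`. -/
abbrev spaceD : Set ℝ := Ioo (-1) 1

/-- The set of directions `Λ = (-1, 1)`. -/
abbrev dirL : Set ℝ := Ioo (-1) 1

/-- The space `L^∞(D)`. -/
abbrev LInfD : Type := Lp ℝ ∞ (volume.restrict spaceD)

/-- The space `L²(D)`. -/
abbrev L2D : Type := Lp ℝ 2 (volume.restrict spaceD)

/-! ### The Bochner-Sobolev space `H¹(Λ; X)` -/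

/-- Test functions on `Λ`: the elements of `C_c^∞(Λ)`. -/
def IsTest (η : ℝ → ℝ) : Prop :=
  ContDiff ℝ ∞ η ∧ HasCompactSupport η ∧ tsupport η ⊆ dirL

section Sobolev

variable {X : Type*} [NormedAddCommGroup X] [NormedSpace ℝ X]

/-- `w` is the weak derivative of `u` on `Λ`: `∫_Λ η' u = - ∫_Λ η w` for all `η ∈ C_c^∞(Λ)`. -/
def IsWeakDeriv (u w : ℝ → X) : Prop :=
  ∀ η : ℝ → ℝ, IsTest η → ∫ μ in dirL, deriv η μ • u μ = -∫ μ in dirL, η μ • w μ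

theorem integrable_smul_Lp {g : ℝ → ℝ} (hg : Continuous g) (hs : HasCompactSupport g)
    (u : Lp X 2 (volume.restrict dirL)) :
    Integrable (fun μ => g μ • u μ) (volume.restrict dirL) := by
  obtain ⟨C, hC⟩ := hs.exists_bound_of_continuous hg
  have hu : Integrable (u : ℝ → X) (volume.restrict dirL) :=
    (Lp.memLp u).integrable (by norm_num)
  exact hu.bdd_smul C hg.aestronglyMeasurable (Filter.Eventually.of_forall hC)

theorem integral_smul_add {g : ℝ → ℝ} (hg : Continuous g) (hs : HasCompactSupport g)
    (u v : Lp X 2 (volume.restrict dirL)) :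
    ∫ μ in dirL, g μ • (u + v : Lp X 2 (volume.restrict dirL)) μ =
      (∫ μ in dirL, g μ • u μ) + ∫ μ in dirL, g μ • v μ := by
  rw [← integral_add (integrable_smul_Lp hg hs u) (integrable_smul_Lp hg hs v)]
  refine integral_congr_ae ?_
  filter_upwards [Lp.coeFn_add u v] with μ h
  rw [h, Pi.add_apply, smul_add]

theorem integral_smul_smul (g : ℝ → ℝ) (a : ℝ) (u : Lp X 2 (volume.restrict dirL)) :
    ∫ μ in dirL, g μ • (a • u : Lp X 2 (volume.restrict dirL)) μ =
      a • ∫ μ in dirL, g μ • u μ := by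
  rw [← integral_smul]
  refine integral_congr_ae ?_
  filter_upwards [Lp.coeFn_smul a u] with μ h
  rw [h, Pi.smul_apply, smul_comm]

theorem integral_smul_zero (g : ℝ → ℝ) :
    ∫ μ in dirL, g μ • (0 : Lp X 2 (volume.restrict dirL)) μ = 0 := by
  have h : (fun μ => g μ • (0 : Lp X 2 (volume.restrict dirL)) μ)
      =ᵐ[volume.restrict dirL] fun _ => (0 : X) := by
    filter_upwards [Lp.coeFn_zero X 2 (volume.restrict dirL)] with μ h
    rw [h, Pi.zero_apply, smul_zero]
  rw [integral_congr_ae h, integral_zero]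

theorem continuous_integral_smul {g : ℝ → ℝ} (hg : Continuous g) (hs : HasCompactSupport g) :
    Continuous fun u : Lp X 2 (volume.restrict dirL) => ∫ μ in dirL, g μ • u μ := by
  obtain ⟨C, hC⟩ := hs.exists_bound_of_continuous hg
  have hC0 : 0 ≤ C := (norm_nonneg _).trans (hC 0)
  let T : Lp X 2 (volume.restrict dirL) →ₗ[ℝ] X :=
    { toFun := fun u => ∫ μ in dirL, g μ • u μ
      map_add' := integral_smul_add hg hs
      map_smul' := fun a u => integral_smul_smul g a u }
  refine (T.mkContinuous (C * ((volume.restrict dirL) univ ^ (1 / 2 : ℝ)).toReal) ?_).continuous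
  intro u
  have hu : Integrable (u : ℝ → X) (volume.restrict dirL) :=
    (Lp.memLp u).integrable (by norm_num)
  have h1 : ‖∫ μ in dirL, g μ • u μ‖ ≤ ∫ μ in dirL, C * ‖u μ‖ := by
    refine norm_integral_le_of_norm_le (hu.norm.const_mul C) (Filter.Eventually.of_forall ?_)
    intro μ
    rw [norm_smul]
    exact mul_le_mul_of_nonneg_right (hC μ) (norm_nonneg _)
  have h2 : eLpNorm u 1 (volume.restrict dirL) ≤ eLpNorm u 2 (volume.restrict dirL) *
      (volume.restrict dirL) univ ^ (1 / 2 : ℝ) := by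
    have := eLpNorm_le_eLpNorm_mul_rpow_measure_univ (p := 1) (q := 2) (by norm_num)
      (Lp.aestronglyMeasurable u)
    norm_num at this ⊢
    exact this
  have h3 : ∫ μ in dirL, ‖u μ‖ ≤ ((volume.restrict dirL) univ ^ (1 / 2 : ℝ)).toReal * ‖u‖ := by
    rw [integral_norm_eq_lintegral_enorm hu.1, ← eLpNorm_one_eq_lintegral_enorm, Lp.norm_def,
      ← ENNReal.toReal_mul, mul_comm]
    refine ENNReal.toReal_mono (ENNReal.mul_ne_top (Lp.eLpNorm_ne_top u) ?_) h2
    exact ENNReal.rpow_ne_top_of_nonneg (by norm_num) (measure_ne_top _ _)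
  calc ‖T u‖ ≤ ∫ μ in dirL, C * ‖u μ‖ := h1
    _ = C * ∫ μ in dirL, ‖u μ‖ := integral_const_mul _ _
    _ ≤ C * (((volume.restrict dirL) univ ^ (1 / 2 : ℝ)).toReal * ‖u‖) :=
        mul_le_mul_of_nonneg_left h3 hC0
    _ = _ := by ring

variable (X) in
/-- The Sobolev space `H¹(Λ; X)` of functions with values in `X`: the pairs `(u, u')` with
`u, u' ∈ L²(Λ; X)` (Bochner) and `u'` the weak derivative of `u`.  As `u'` is determined by `u`,
such a pair is the same as the function `u`; the norm inherited from the product is the usual one,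
`(‖u‖² + ‖u'‖²)^{1/2}`. -/
def H1 : Submodule ℝ
    (WithLp 2 (Lp X 2 (volume.restrict dirL) × Lp X 2 (volume.restrict dirL))) where
  carrier := {p | IsWeakDeriv (p.fst : ℝ → X) (p.snd : ℝ → X)}
  zero_mem' := by
    intro η _
    simp only [WithLp.zero_fst, WithLp.zero_snd]
    rw [integral_smul_zero, integral_smul_zero, neg_zero]
  add_mem' := by
    intro p q hp hq η hη
    have hd : Continuous (deriv η) := hη.1.continuous_deriv (by simp)
    simp only [WithLp.add_fst, WithLp.add_snd]
    rw [integral_smul_add hd hη.2.1.deriv, integral_smul_add hη.1.continuous hη.2.1,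
      hp η hη, hq η hη, neg_add]
  smul_mem' := by
    intro a p hp η hη
    simp only [WithLp.smul_fst, WithLp.smul_snd]
    rw [integral_smul_smul, integral_smul_smul, hp η hη, smul_neg]

/-- `H¹(Λ; X)` is a Banach space if `X` is, so that Bochner integrals of `H¹(Λ; X)`-valued functions
make sense. -/
instance [CompleteSpace X] : CompleteSpace (H1 X) := by
  have hcl : IsClosed ((H1 X : Set (WithLp 2
      (Lp X 2 (volume.restrict dirL) × Lp X 2 (volume.restrict dirL))))) := by
    have : (H1 X : Set (WithLp 2
        (Lp X 2 (volume.restrict dirL) × Lp X 2 (volume.restrict dirL)))) =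
        ⋂ η : ℝ → ℝ, ⋂ _ : IsTest η, {p | ∫ μ in dirL, deriv η μ • p.fst μ =
          -∫ μ in dirL, η μ • p.snd μ} := by
      ext p
      simp only [mem_iInter]
      rfl
    rw [this]
    refine isClosed_iInter fun η => isClosed_iInter fun hη => isClosed_eq ?_ ?_
    · exact (continuous_integral_smul (hη.1.continuous_deriv (by simp)) hη.2.1.deriv).comp
        (continuous_fst.comp (WithLp.prod_continuous_ofLp 2 _ _))
    · exact ((continuous_integral_smul hη.1.continuous hη.2.1).comp
        (continuous_snd.comp (WithLp.prod_continuous_ofLp 2 _ _))).neg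
  exact hcl.completeSpace_coe

/-- The function underlying an element of `H¹(Λ; X)`. -/
def evalH1 (u : H1 X) : ℝ → X := fun μ => u.1.fst μ

end Sobolev

/-- `(ν, μ) ↦ σ(·, ν, μ)` is (the continuous representative on `Λ × Λ` of) an element of
`H¹(Λ_ν; H¹(Λ_μ; L^∞(D)))`.  Every element of this space has exactly one continuous
representative on `Λ × Λ`; it is the one whose nodal values are meant. -/
def MemH1H1 (σ : ℝ → ℝ → LInfD) : Prop :=
  ContinuousOn (fun p : ℝ × ℝ => σ p.1 p.2) (dirL ×ˢ dirL) ∧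
    ∃ S : H1 (H1 LInfD), ∀ᵐ ν ∂(volume.restrict dirL), ∀ᵐ μ ∂(volume.restrict dirL),
      σ ν μ = evalH1 (evalH1 S ν) μ

/-! ### Legendre-Gauss quadrature -/

/-- The Legendre polynomial
`L_n(x) = ∑_{k ≤ n} C(n,k) C(n+k,n) ((x-1)/2)^k`, i.e. the shifted Legendre polynomial
`∑_{k ≤ n} (-1)^k C(n,k) C(n+k,n) y^k` at `y = (1-x)/2`. -/
def legendre (n : ℕ) : ℝ[X] :=
  ((shiftedLegendre n).map (Int.castRingHom ℝ)).comp (C (1 / 2) * (1 - X))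

/-- The Legendre-Gauss nodes `μ_0, …, μ_M`: the zeros of `L_{M+1}`. -/
def nodes (M : ℕ) : Finset ℝ := (legendre (M + 1)).roots.toFinset

/-- The Christoffel number `2 / ((1 - μ²) L_{M+1}'(μ)²)` belonging to the node `μ`. -/
def weight (M : ℕ) (μ : ℝ) : ℝ :=
  2 / ((1 - μ ^ 2) * ((derivative (legendre (M + 1))).eval μ) ^ 2)

/-! ### The discrete spaces

A polynomial in `μ` with values in the polynomials in `x` is an element `φ` of `ℝ[X][Y]`, the
outer variable being `μ`; its value at the direction `μ` is `φ.eval (C μ) : ℝ[X]`, and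
`φ.evalEval x μ = φ(x, μ)`. -/

/-- `W_N^M = P_M(Λ; P_N(D))`. -/
def trialSpace (M N : ℕ) : Set ℝ[X][Y] :=
  {φ | φ.natDegree ≤ M ∧ ∀ j, (φ.coeff j).natDegree ≤ N}

/-- The space `P_N^m(D)` belonging to the node `μ = μ_m`: the polynomials of degree at most `N`
vanishing at the inflow boundary point, which is `-1` if `μ > 0` and `1` if `μ < 0`; there is none
if `μ = 0`. -/
def nodalSpace (N : ℕ) (μ : ℝ) : Set ℝ[X] :=
  {v | v.natDegree ≤ N ∧ (0 < μ → v.eval (-1) = 0) ∧ (μ < 0 → v.eval 1 = 0)}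

/-- The subspace of `W_N^M` given by the vacuum boundary conditions at the nodes. -/
def vacuumSpace (M N : ℕ) : Set ℝ[X][Y] :=
  {φ | φ ∈ trialSpace M N ∧ ∀ μ ∈ nodes M, φ.eval (C μ) ∈ nodalSpace N μ}

/-! ### The discrete transport problem -/

/-- `(L_M φ)(x, μ) = μ ∂ₓφ(x,μ) + Σ_t(x,μ) φ(x,μ) - ½ ∑_i ω_i Σ_s(x,ν_i,μ) φ(x,ν_i)`.
The arguments of `sigS` are, in this order, `ν` and `μ`, its values are functions of `x`. -/
def opLM (M : ℕ) (sigT : ℝ → LInfD) (sigS : ℝ → ℝ → LInfD) (φ : ℝ[X][Y]) (x μ : ℝ) : ℝ :=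
  μ * (derivative (φ.eval (C μ))).eval x + sigT μ x * φ.evalEval x μ
    - 1 / 2 * ∑ ν ∈ nodes M, weight M ν * sigS ν μ x * φ.evalEval x ν

/-- The inner product `(u, v) = ∫_D u v dx`. -/
def innerD (u v : ℝ → ℝ) : ℝ := ∫ x in spaceD, u x * v x

/-- `⟨u, v⟩_M = ∑_m ω_m (u(μ_m), v(μ_m))`; the arguments of `u` and `v` are `x` and `μ`. -/
def innerM (M : ℕ) (u v : ℝ → ℝ → ℝ) : ℝ :=
  ∑ μ ∈ nodes M, weight M μ * innerD (fun x => u x μ) (fun x => v x μ)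

/-- The norm `|||u|||` of `L²(D × Λ)`. -/
def tripleNorm (u : ℝ → ℝ → ℝ) : ℝ :=
  Real.sqrt (∫ μ in dirL, innerD (fun x => u x μ) (fun x => u x μ))

/-- `φ ∈ W_N^M` solves the discrete problem with source `s` and inflow data `gl`, `gr`. -/
def IsDiscreteSolution (M N : ℕ) (sigT : ℝ → LInfD) (sigS : ℝ → ℝ → LInfD)
    (s : ℝ → L2D) (gl gr : ℝ → ℝ) (φ : ℝ[X][Y]) : Prop :=
  φ ∈ trialSpace M N ∧
  (∀ μ ∈ nodes M, ∀ v ∈ nodalSpace N μ,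
    innerD (fun x => opLM M sigT sigS φ x μ) (fun x => v.eval x)
      = 1 / 2 * innerD (s μ) (fun x => v.eval x)) ∧
  (∀ μ ∈ nodes M, 0 < μ → φ.evalEval (-1) μ = gl μ) ∧
  (∀ μ ∈ nodes M, μ < 0 → φ.evalEval 1 μ = gr μ)

end

end NeutronTransport

/-! Gauss weights are positive and the rule is exact up to degree `2 * M + 1`, so subcriticality
survives quadrature once the scattering integrals are computed accurately enough, uniformly in the
frozen direction.

Uniformity comes from regularity: in one variable `H¹` embeds into the functions that are Hölder
continuous with exponent 1/2, so `σ` is Hölder in each direction with one constant `4 * ‖S‖`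
(`MemH1H1.exists_halfHolder`). On such a class Gauss quadrature converges uniformly
(`exists_quadrature_error_le`), by exactness on Bernstein approximants. An error of at most `c` in
`L^∞(D)`, multiplied by the factor 1/2 of the scattering term, leaves the constant `c / 2` at the
nodes (`exists_nodalSubcritical`); the space degree `N` plays no role.

Coercivity (`NodalSubcritical.coercive`) is then algebra: streaming integrates to the outflow terms,
scattering is absorbed by Young's inequality using both subcriticality conditions, and the discrete
norm equals the continuous one because the square of a trial function has degree at most `2 * M` in
`μ`.

For solvability, coercivity makes the form definite on a finite-dimensional space, hence bijective
onto the dual. Lagrange interpolation in `μ` lifts the inflow data and separates the nodal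
equations. -/

namespace NeutronTransport

/-! ### Integrals of polynomials over `(-1, 1)` -/

/-- The integral of a polynomial over `(-1, 1)`, as a linear functional. -/
noncomputable def polyInt : ℝ[X] →ₗ[ℝ] ℝ where
  toFun p := ∫ x in (-1 : ℝ)..1, p.eval x
  map_add' p q := by
    simp only [eval_add]
    exact intervalIntegral.integral_add (p.continuous.intervalIntegrable _ _)
      (q.continuous.intervalIntegrable _ _)
  map_smul' a p := by
    simp only [eval_smul, smul_eq_mul, RingHom.id_apply]
    exact intervalIntegral.integral_const_mul _ _

theorem polyInt_apply (p : ℝ[X]) : polyInt p = ∫ x in (-1 : ℝ)..1, p.eval x := rfl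

theorem setIntegral_eval (p : ℝ[X]) : ∫ x in Ioo (-1 : ℝ) 1, p.eval x = polyInt p := by
  rw [polyInt_apply, intervalIntegral.integral_of_le (by norm_num), integral_Ioc_eq_integral_Ioo]

theorem polyInt_derivative (p : ℝ[X]) : polyInt (derivative p) = p.eval 1 - p.eval (-1) := by
  rw [polyInt_apply]
  exact intervalIntegral.integral_eq_sub_of_hasDerivAt (fun x _ => p.hasDerivAt x)
    ((derivative p).continuous.intervalIntegrable _ _)

theorem polyInt_derivative_mul (p q : ℝ[X]) :
    polyInt (derivative p * q) =
      p.eval 1 * q.eval 1 - p.eval (-1) * q.eval (-1) - polyInt (p * derivative q) := by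
  have h := polyInt_derivative (p * q)
  rw [derivative_mul, map_add, eval_mul, eval_mul] at h
  linarith

theorem polyInt_C_mul (a : ℝ) (p : ℝ[X]) : polyInt (C a * p) = a * polyInt p := by
  rw [← smul_eq_C_mul, map_smul, smul_eq_mul]

theorem exists_Ioo_eval_ne_zero {p : ℝ[X]} (hp : p ≠ 0) : ∃ x ∈ Ioo (-1 : ℝ) 1, p.eval x ≠ 0 := by
  by_contra! h
  refine (Ioo_infinite (show (-1 : ℝ) < 1 by norm_num)) ?_
  refine (p.roots.toFinset.finite_toSet).subset fun x hx => ?_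
  simpa [hp] using h x hx

theorem polyInt_pos {p : ℝ[X]} (hp : p ≠ 0) (h : ∀ x ∈ Icc (-1 : ℝ) 1, 0 ≤ p.eval x) :
    0 < polyInt p := by
  obtain ⟨x, hx, hne⟩ := exists_Ioo_eval_ne_zero hp
  refine intervalIntegral.integral_pos (by norm_num) p.continuous.continuousOn
    (fun y hy => h y (Ioc_subset_Icc_self hy)) ⟨x, Ioo_subset_Icc_self hx, ?_⟩
  exact lt_of_le_of_ne (h x (Ioo_subset_Icc_self hx)) hne.symm

theorem polyInt_sq_nonneg (p : ℝ[X]) : 0 ≤ polyInt (p * p) := by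
  rw [polyInt_apply]
  refine intervalIntegral.integral_nonneg (by norm_num) fun x _ => ?_
  rw [eval_mul]
  exact mul_self_nonneg _

theorem polyInt_sq_eq_zero {p : ℝ[X]} (h : polyInt (p * p) = 0) : p = 0 := by
  by_contra hp
  refine (polyInt_pos (mul_ne_zero hp hp) fun x _ => ?_).ne' h
  rw [eval_mul]
  exact mul_self_nonneg _

/-! ### Legendre polynomials -/

theorem iterate_derivative_comp_affine (p : ℝ[X]) (n : ℕ) :
    derivative^[n] (p.comp (C (1 / 2) * (1 - X))) =
      C ((-1 / 2) ^ n) * (derivative^[n] p).comp (C (1 / 2) * (1 - X)) := by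
  induction n with
  | zero => simp
  | succ n ih =>
    rw [Function.iterate_succ_apply', ih, Function.iterate_succ_apply', derivative_C_mul,
      derivative_comp]
    have : derivative (C (1 / 2) * (1 - X) : ℝ[X]) = C (-1 / 2) := by
      rw [derivative_C_mul]; simp; rw [← C_neg]; congr 1; norm_num
    rw [this, pow_succ, C_mul]
    ring

/-- Rodrigues' formula. -/
theorem rodrigues (n : ℕ) :
    ∃ a : ℝ, a ≠ 0 ∧ legendre n = C a * derivative^[n] (((X - C 1) * (X - C (-1))) ^ n) := by
  have h := congrArg (fun p : ℤ[X] => (p.map (Int.castRingHom ℝ)).comp (C (1 / 2) * (1 - X)))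
    (factorial_mul_shiftedLegendre_eq n)
  simp only [Polynomial.map_mul, mul_comp, ← iterate_derivative_map] at h
  have h2 := iterate_derivative_comp_affine ((X ^ n * (1 - X) ^ n : ℤ[X]).map (Int.castRingHom ℝ)) n
  rw [← Polynomial.map_mul] at h
  rw [← h] at h2
  -- With y = (1 - x)/2 one has y(1 - y) = -(x - 1)(x + 1)/4; the powers of -1/2 come from the chain
  -- rule.
  have h3 : ((X ^ n * (1 - X) ^ n : ℤ[X]).map (Int.castRingHom ℝ)).comp (C (1 / 2) * (1 - X)) =
      C ((-1 / 4) ^ n) * ((X - C 1) * (X - C (-1))) ^ n := by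
    simp only [Polynomial.map_mul, Polynomial.map_pow, Polynomial.map_sub, Polynomial.map_one,
      map_X, mul_comp, pow_comp, sub_comp, one_comp, X_comp]
    rw [← mul_pow, C_pow, ← mul_pow]
    congr 1
    have e1 : (C (1 / 2) : ℝ[X]) = C (1 / 2) * 1 := by ring
    have e2 : (1 : ℝ[X]) = C (1 / 2) * 2 := by
      rw [← C_ofNat, ← C_mul]; norm_num
    have e3 : (C (-1 / 4) : ℝ[X]) = - (C (1 / 2) * C (1 / 2)) := by
      rw [← C_mul, ← C_neg]; norm_num
    rw [e3, C_neg, C_1]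
    have e4 : (1 : ℝ[X]) - C (1 / 2) * (1 - X) = C (1 / 2) * (1 + X) := by
      linear_combination e2
    rw [e4]
    ring
  rw [h3, iterate_derivative_C_mul] at h2
  have h4 : ((n.factorial : ℤ[X]).map (Int.castRingHom ℝ)).comp (C (1 / 2) * (1 - X)) =
      C (n.factorial : ℝ) := by simp
  rw [h4, ← mul_assoc, ← C_mul] at h2
  have hb : ((-1 / 2 : ℝ) ^ n * n.factorial) ≠ 0 :=
    mul_ne_zero (pow_ne_zero _ (by norm_num)) (by exact_mod_cast n.factorial_ne_zero)
  refine ⟨((-1 / 2 : ℝ) ^ n * n.factorial)⁻¹ * (-1 / 4) ^ n,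
    mul_ne_zero (inv_ne_zero hb) (pow_ne_zero _ (by norm_num)), ?_⟩
  rw [C_mul, mul_assoc, h2, ← mul_assoc, ← C_mul, inv_mul_cancel₀ hb]
  simp [legendre]

theorem natDegree_legendre (n : ℕ) : (legendre n).natDegree = n := by
  have h1 : (C (1 / 2) * (1 - X) : ℝ[X]).natDegree = 1 := by
    rw [natDegree_C_mul (by norm_num), ← natDegree_neg, neg_sub, ← C_1, natDegree_X_sub_C]
  rw [legendre, natDegree_comp, h1, mul_one,
    natDegree_map_eq_of_injective (Int.castRingHom ℝ).injective_int, natDegree_shiftedLegendre]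

theorem legendre_ne_zero (n : ℕ) : legendre n ≠ 0 := by
  rcases n.eq_zero_or_pos with rfl | hn
  · simp [legendre, shiftedLegendre]
  · intro h
    have := natDegree_legendre n
    rw [h, natDegree_zero] at this
    omega

theorem eval_one_legendre (n : ℕ) : (legendre n).eval 1 = 1 := by
  rw [legendre, eval_comp]
  simp only [eval_mul, eval_C, eval_sub, eval_one, eval_X, sub_self, mul_zero]
  rw [← coeff_zero_eq_eval_zero, coeff_map, coeff_shiftedLegendre]
  simp

/-- Reflection symmetry relates the two endpoints up to a sign. The Christoffel formula needs only
the square, so the sign is dropped. -/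
theorem eval_neg_one_legendre_sq (n : ℕ) : (legendre n).eval (-1) ^ 2 = 1 := by
  have h0 : (((shiftedLegendre n).map (Int.castRingHom ℝ)).eval 0) = 1 := by
    have := eval_one_legendre n
    rw [legendre, eval_comp] at this
    simpa using this
  have h := shiftedLegendre_eval_symm n (1 : ℝ)
  rw [sub_self] at h
  rw [aeval_def, aeval_def, ← eval_map, ← eval_map, algebraMap_int_eq, h0, mul_one] at h
  rw [legendre, eval_comp]
  have : eval (-1) (C (1 / 2) * (1 - X) : ℝ[X]) = 1 := by simp; norm_num
  rw [this, h, ← pow_mul, mul_comm, pow_mul]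
  norm_num

/-- Repeated integration by parts: `1` and `-1` are zeros of order `n`, so boundary terms vanish as
long as fewer than `n` derivatives are taken, while `q` loses a degree each time. -/
theorem polyInt_iterate_derivative_mul (n k : ℕ) (hk : k ≤ n) (q : ℝ[X]) (hq : q.degree < k) :
    polyInt (derivative^[k] (((X - C 1) * (X - C (-1))) ^ n) * q) = 0 := by
  induction k generalizing q with
  | zero =>
    have : q = 0 := by
      simpa using hq
    simp [this]
  | succ k ih =>
    have hroot : ∀ a : ℝ, (X - C a) ∣ ((X - C 1) * (X - C (-1)) : ℝ[X]) →
        (derivative^[k] (((X - C 1) * (X - C (-1))) ^ n : ℝ[X])).eval a = 0 := by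
      intro a ha
      have h := pow_sub_dvd_iterate_derivative_of_pow_dvd k (pow_dvd_pow_of_dvd ha n)
      exact dvd_iff_isRoot.1 ((dvd_pow_self _ (by omega)).trans h)
    rw [Function.iterate_succ_apply', polyInt_derivative_mul, hroot 1 (dvd_mul_right _ _),
      hroot (-1) (dvd_mul_left _ _), ih (by omega)]
    · ring
    · by_cases h0 : q = 0
      · simp [h0]
      rcases k.eq_zero_or_pos with rfl | hk0
      · have : q.natDegree = 0 := by
          rw [degree_eq_natDegree h0] at hq
          norm_cast at hq
          omega
        rw [derivative_of_natDegree_zero this]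
        simp
      · refine (degree_derivative_lt h0).trans_le ?_
        rw [degree_eq_natDegree h0] at hq ⊢
        norm_cast at hq ⊢
        omega

theorem polyInt_legendre_mul (n : ℕ) (q : ℝ[X]) (hq : q.degree < n) :
    polyInt (legendre n * q) = 0 := by
  obtain ⟨a, -, h⟩ := rodrigues n
  rw [h, mul_assoc, polyInt_C_mul, polyInt_iterate_derivative_mul n n le_rfl q hq, mul_zero]

/-- Rolle with multiplicity: each derivative loses at most one root, and Rodrigues' formula starts
from `2 * n` of them. -/
theorem card_roots_legendre (n : ℕ) : (legendre n).roots.card = n := by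
  obtain ⟨a, ha, h⟩ := rodrigues n
  refine le_antisymm ((card_roots' _).trans (natDegree_legendre n).le) ?_
  have h0 : ((X - C 1) * (X - C (-1)) : ℝ[X]) ≠ 0 :=
    mul_ne_zero (X_sub_C_ne_zero _) (X_sub_C_ne_zero _)
  have key : ∀ k : ℕ, 2 * n ≤
      (derivative^[k] (((X - C 1) * (X - C (-1))) ^ n : ℝ[X])).roots.card + k := by
    intro k
    induction k with
    | zero =>
      rw [Function.iterate_zero_apply, roots_pow, roots_mul h0, roots_X_sub_C, roots_X_sub_C]
      simp [mul_comm]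
    | succ k ih =>
      rw [Function.iterate_succ_apply']
      have := card_roots_le_derivative (derivative^[k] (((X - C 1) * (X - C (-1))) ^ n : ℝ[X]))
      omega
  rw [h, roots_C_mul _ ha]
  have := key n
  omega

/-- If L = (X - a)² q, orthogonality to `q` says that the integral of ((X - a) q)² vanishes. -/
theorem nodup_roots_legendre (n : ℕ) : (legendre n).roots.Nodup := by
  classical
  rw [Multiset.nodup_iff_count_le_one]
  intro a
  rw [count_roots]
  by_contra! h
  obtain ⟨q, hq⟩ := (le_rootMultiplicity_iff (legendre_ne_zero n)).1 (show 2 ≤ _ from h)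
  have hq0 : q ≠ 0 := by
    rintro rfl
    exact legendre_ne_zero n (by simpa using hq)
  have hdeg : q.natDegree + 2 = n := by
    rw [← natDegree_legendre n, hq, natDegree_mul (pow_ne_zero _ (X_sub_C_ne_zero a)) hq0,
      natDegree_pow, natDegree_X_sub_C]
    omega
  have h1 := polyInt_legendre_mul n q (by
    rw [degree_eq_natDegree hq0]; norm_cast; omega)
  rw [hq, show (X - C a) ^ 2 * q * q = ((X - C a) * q) * ((X - C a) * q) by ring] at h1
  exact mul_ne_zero (X_sub_C_ne_zero a) hq0 (polyInt_sq_eq_zero h1)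

/-- If L = (X - a) q with `a` outside the open interval, then L q = (X - a) q² has a fixed sign,
against orthogonality to `q`. -/
theorem root_legendre_mem_Ioo (n : ℕ) {a : ℝ} (h : (legendre n).eval a = 0) :
    a ∈ Ioo (-1 : ℝ) 1 := by
  obtain ⟨q, hq⟩ := dvd_iff_isRoot.2 h
  have hq0 : q ≠ 0 := by
    rintro rfl
    exact legendre_ne_zero n (by simpa using hq)
  have hdeg : q.natDegree + 1 = n := by
    rw [← natDegree_legendre n, hq, natDegree_mul (X_sub_C_ne_zero a) hq0, natDegree_X_sub_C]
    omega
  have h1 := polyInt_legendre_mul n q (by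
    rw [degree_eq_natDegree hq0]; norm_cast; omega)
  rw [hq] at h1
  have hne := mul_ne_zero (mul_ne_zero (X_sub_C_ne_zero a) hq0) hq0
  constructor
  · by_contra! ha
    refine (polyInt_pos hne fun x hx => ?_).ne' h1
    rw [mul_assoc, eval_mul, eval_mul, eval_sub, eval_X, eval_C]
    exact mul_nonneg (by linarith [hx.1]) (mul_self_nonneg _)
  · by_contra! ha
    refine (polyInt_pos (neg_ne_zero.2 hne) fun x hx => ?_).ne' (by rw [map_neg, h1, neg_zero])
    rw [mul_assoc, eval_neg, eval_mul, eval_mul, eval_sub, eval_X, eval_C, ← neg_mul]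
    exact mul_nonneg (by linarith [hx.2]) (mul_self_nonneg _)

/-! ### Legendre-Gauss quadrature -/

theorem mem_nodes {M : ℕ} {μ : ℝ} : μ ∈ nodes M ↔ (legendre (M + 1)).eval μ = 0 := by
  rw [nodes, Multiset.mem_toFinset, mem_roots (legendre_ne_zero _), IsRoot.def]

theorem nodes_subset {M : ℕ} {μ : ℝ} (h : μ ∈ nodes M) : μ ∈ dirL :=
  root_legendre_mem_Ioo _ (mem_nodes.1 h)

theorem card_nodes (M : ℕ) : (nodes M).card = M + 1 := by
  rw [nodes, Multiset.toFinset_card_of_nodup (nodup_roots_legendre _), card_roots_legendre]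

/-- The interpolatory weights at the Legendre-Gauss nodes. -/
noncomputable def interpWeight (M : ℕ) (μ : ℝ) : ℝ := polyInt (Lagrange.basis (nodes M) id μ)

/-- Divide by the Legendre polynomial: the quotient has degree at most `M` and is orthogonal to it,
while the remainder agrees with `p` at the nodes and equals its own interpolant. -/
theorem polyInt_eq_sum_interpWeight {M : ℕ} {p : ℝ[X]} (hp : p.degree < (2 * M + 2 : ℕ)) :
    polyInt p = ∑ μ ∈ nodes M, interpWeight M μ * p.eval μ := by
  have hL := legendre_ne_zero (M + 1)
  have hLd : (legendre (M + 1)).degree = (M + 1 : ℕ) := by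
    rw [degree_eq_natDegree hL, natDegree_legendre]
  have hmod : (p % legendre (M + 1)).degree < (nodes M).card := by
    rw [card_nodes, ← hLd]
    exact degree_mod_lt p hL
  have hdiv : (p / legendre (M + 1)).degree < (M + 1 : ℕ) := by
    by_cases hlt : p.degree < (legendre (M + 1)).degree
    · rw [(Polynomial.div_eq_zero_iff hL).2 hlt]
      exact WithBot.bot_lt_coe (M + 1)
    · have h0 : p / legendre (M + 1) ≠ 0 := fun h => hlt ((Polynomial.div_eq_zero_iff hL).1 h)
      have := degree_add_div hL (not_lt.1 hlt)
      rw [hLd, degree_eq_natDegree h0] at this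
      rw [← this, ← Nat.cast_add] at hp
      rw [degree_eq_natDegree h0]
      have h2 := Nat.cast_lt.1 hp
      exact Nat.cast_lt.2 (by omega)
  have hev : ∀ μ ∈ nodes M, (p % legendre (M + 1)).eval μ = p.eval μ := by
    intro μ hμ
    conv_rhs => rw [← EuclideanDomain.mod_add_div p (legendre (M + 1))]
    rw [eval_add, eval_mul, mem_nodes.1 hμ, zero_mul, add_zero]
  conv_lhs => rw [← EuclideanDomain.mod_add_div p (legendre (M + 1))]
  rw [map_add, polyInt_legendre_mul _ _ hdiv, add_zero,
    Lagrange.eq_interpolate (s := nodes M) (v := id) (injOn_id _) hmod, Lagrange.interpolate_apply,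
    map_sum]
  refine Finset.sum_congr rfl fun μ hμ => ?_
  rw [polyInt_C_mul, mul_comm, id, hev μ hμ, interpWeight]

/-- The Christoffel numbers are the interpolatory weights. -/
theorem interpWeight_eq_weight {M : ℕ} {a : ℝ} (ha : a ∈ nodes M) :
    interpWeight M a = weight M a := by
  -- Write L = (X - a) q. Quadrature of L' q sees only the node `a` and gives the weight times
  -- L'(a)². Integrating by parts, with ∫ q' L = 0 by orthogonality, gives (1 - a) q(1)² + (1 + a)
  -- q(-1)² = 2/(1 - a²).
  obtain ⟨q, hq⟩ := dvd_iff_isRoot.2 (mem_nodes.1 ha)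
  have hLne := legendre_ne_zero (M + 1)
  have hq0 : q ≠ 0 := by
    rintro rfl
    exact hLne (by simpa using hq)
  have hdeg : q.natDegree = M := by
    have := natDegree_legendre (M + 1)
    rw [hq, natDegree_mul (X_sub_C_ne_zero a) hq0, natDegree_X_sub_C] at this
    omega
  have hder : derivative (legendre (M + 1)) = q + (X - C a) * derivative q := by
    rw [hq, derivative_mul, derivative_X_sub_C, one_mul]
  have hqa : q.eval a = (derivative (legendre (M + 1))).eval a := by
    rw [hder]; simp
  have hq_other : ∀ μ ∈ nodes M, μ ≠ a → q.eval μ = 0 := by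
    intro μ hμ hne
    have h := mem_nodes.1 hμ
    rw [hq, eval_mul, eval_sub, eval_X, eval_C] at h
    exact (mul_eq_zero.1 h).resolve_left (sub_ne_zero.2 hne)
  have hqane : q.eval a ≠ 0 := by
    intro h
    have h2 : 2 ≤ rootMultiplicity a (legendre (M + 1)) := by
      rw [le_rootMultiplicity_iff hLne, hq, sq]
      exact mul_dvd_mul_left _ (dvd_iff_isRoot.2 h)
    have h3 := Multiset.nodup_iff_count_le_one.1 (nodup_roots_legendre (M + 1)) a
    rw [count_roots] at h3
    omega
  have hq2 : (q * q).degree < (2 * M + 2 : ℕ) := by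
    rw [degree_eq_natDegree (mul_ne_zero hq0 hq0), natDegree_mul hq0 hq0]
    exact Nat.cast_lt.2 (by omega)
  have hd : (derivative (legendre (M + 1)) * q).degree < (2 * M + 2 : ℕ) := by
    refine (degree_le_natDegree).trans_lt (Nat.cast_lt.2 ?_)
    refine (natDegree_mul_le).trans_lt ?_
    have := natDegree_derivative_le (legendre (M + 1))
    rw [natDegree_legendre] at this
    omega
  have e1 : polyInt (q * q) = interpWeight M a * q.eval a ^ 2 := by
    rw [polyInt_eq_sum_interpWeight hq2, Finset.sum_eq_single_of_mem a ha]
    · rw [eval_mul]; ring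
    · intro μ hμ hne
      rw [eval_mul, hq_other μ hμ hne]; ring
  have e2 : polyInt (derivative (legendre (M + 1)) * q) = interpWeight M a * q.eval a ^ 2 := by
    rw [polyInt_eq_sum_interpWeight hd, Finset.sum_eq_single_of_mem a ha]
    · rw [eval_mul, ← hqa]; ring
    · intro μ hμ hne
      rw [eval_mul, hq_other μ hμ hne]; ring
  have e3 : polyInt (derivative q * ((X - C a) * q)) = 0 := by
    rw [mul_comm, ← hq]
    refine polyInt_legendre_mul _ _ ?_
    refine (degree_le_natDegree).trans_lt (Nat.cast_lt.2 ?_)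
    have := natDegree_derivative_le q
    omega
  have e4 := polyInt_derivative_mul q ((X - C a) * q)
  have e5 : derivative ((X - C a) * q) = derivative (legendre (M + 1)) := by rw [← hq]
  rw [e3, e5, mul_comm q (derivative _), e2] at e4
  obtain ⟨h1, h2⟩ := nodes_subset ha
  have f1 : (1 - a) * q.eval 1 = 1 := by
    have := eval_one_legendre (M + 1)
    rw [hq, eval_mul, eval_sub, eval_X, eval_C] at this
    exact this
  have f2 : ((-1 - a) * q.eval (-1)) ^ 2 = 1 := by
    have := eval_neg_one_legendre_sq (M + 1)
    rw [hq, eval_mul, eval_sub, eval_X, eval_C] at this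
    exact this
  simp only [eval_mul, eval_sub, eval_X, eval_C] at e4
  have g1 : (1 - a) ≠ 0 := by linarith
  have g2 : (1 + a) ≠ 0 := by linarith
  have f1' : q.eval 1 = 1 / (1 - a) := by field_simp; linarith
  have f2' : q.eval (-1) ^ 2 = 1 / (1 + a) ^ 2 := by field_simp; linarith [f2]
  rw [weight, ← hqa]
  have g3 : (1 - a ^ 2) ≠ 0 := by
    rw [show 1 - a ^ 2 = (1 - a) * (1 + a) by ring]; exact mul_ne_zero g1 g2
  rw [eq_div_iff (mul_ne_zero g3 (pow_ne_zero 2 hqane))]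
  have e6 : interpWeight M a * q.eval a ^ 2 =
      (1 - a) * (1 / (1 - a)) ^ 2 + (1 + a) * (1 / (1 + a) ^ 2) := by
    rw [← f2', ← f1']; linarith
  calc interpWeight M a * ((1 - a ^ 2) * q.eval a ^ 2)
      = (1 - a ^ 2) * (interpWeight M a * q.eval a ^ 2) := by ring
    _ = 2 := by rw [e6]; field_simp; ring

theorem weight_pos {M : ℕ} {μ : ℝ} (h : μ ∈ nodes M) : 0 < weight M μ := by
  have hne : (derivative (legendre (M + 1))).eval μ ≠ 0 := by
    intro h0
    have h2 := (one_lt_rootMultiplicity_iff_isRoot (legendre_ne_zero (M + 1)) (t := μ)).2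
      ⟨mem_nodes.1 h, h0⟩
    have h3 := Multiset.nodup_iff_count_le_one.1 (nodup_roots_legendre (M + 1)) μ
    rw [count_roots] at h3
    omega
  obtain ⟨h1, h2⟩ := nodes_subset h
  have : 0 < 1 - μ ^ 2 := by nlinarith
  exact div_pos two_pos (mul_pos this (pow_pos (abs_pos.2 hne) 2 |>.trans_eq (sq_abs _)))

/-- Legendre-Gauss quadrature is exact for polynomials of degree at most `2 M + 1`. -/
theorem gauss_exact {M : ℕ} {p : ℝ[X]} (hp : p.natDegree ≤ 2 * M + 1) :
    ∑ μ ∈ nodes M, weight M μ * p.eval μ = polyInt p := by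
  rw [polyInt_eq_sum_interpWeight
    (degree_le_natDegree.trans_lt (Nat.cast_lt.2 (by omega : p.natDegree < 2 * M + 2)))]
  exact Finset.sum_congr rfl fun μ hμ => by rw [interpWeight_eq_weight hμ]

theorem sum_weight (M : ℕ) : ∑ μ ∈ nodes M, weight M μ = 2 := by
  have h := gauss_exact (M := M) (p := 1) (by simp)
  simp only [eval_one, mul_one] at h
  rw [h, polyInt_apply]
  simp
  norm_num

end NeutronTransport

namespace NeutronTransport

/-! ### Uniform convergence of Legendre-Gauss quadrature -/

/-- The Bernstein polynomials of degree `n`, transported to `[-1, 1]`. -/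
noncomputable def bernsteinSymm (n k : ℕ) : ℝ[X] :=
  (bernsteinPolynomial ℝ n k).comp (C (1 / 2) * (X + 1))

theorem eval_bernsteinSymm (n k : ℕ) {x : ℝ} (hx : (x + 1) / 2 ∈ unitInterval) :
    (bernsteinSymm n k).eval x = bernstein n k ⟨(x + 1) / 2, hx⟩ := by
  have h : (C (1 / 2) * (X + 1) : ℝ[X]).eval x = (x + 1) / 2 := by simp; ring
  rw [bernsteinSymm, eval_comp, h]
  rfl

theorem half_add_one_mem_unitInterval {x : ℝ} (hx : x ∈ dirL) : (x + 1) / 2 ∈ unitInterval :=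
  ⟨by linarith [hx.1], by linarith [hx.2]⟩

theorem natDegree_bernsteinSymm_le (n : ℕ) (k : Fin (n + 1)) :
    (bernsteinSymm n k).natDegree ≤ n := by
  have h1 : (C (1 / 2) * (X + 1) : ℝ[X]).natDegree ≤ 1 :=
    (natDegree_C_mul_le _ _).trans (by rw [← C_1, natDegree_X_add_C])
  have h2 : (bernsteinPolynomial ℝ n k).natDegree ≤ n := by
    have hk : (k : ℕ) ≤ n := k.is_le
    rw [bernsteinPolynomial]
    refine (natDegree_mul_le_of_le (m := k) (n := n - k)
      ?_ ?_).trans ?_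
    · exact natDegree_mul_le.trans (by simp)
    · refine (natDegree_pow_le_of_le (m := 1) _ ?_).trans (by omega)
      exact (natDegree_sub_le_of_le (m := 1) (natDegree_one.le.trans zero_le_one)
        natDegree_X_le).trans (by simp)
    · omega
  rw [bernsteinSymm]
  calc _ ≤ _ := natDegree_comp_le
    _ ≤ n * 1 := Nat.mul_le_mul h2 h1
    _ = n := mul_one n

/-- Interior points close to the equidistant points of `[-1, 1]`. -/
noncomputable def samplePoint (n k : ℕ) : ℝ := (2 * k - n) / (n + 1)

/-- The denominator `n + 1`, in place of `n`, keeps the extreme points away from `-1` and `1`, where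
nothing is known about `f`. -/
theorem samplePoint_mem (n : ℕ) (k : Fin (n + 1)) : samplePoint n k ∈ dirL := by
  have hk : ((k : ℕ) : ℝ) ≤ n := by exact_mod_cast k.is_le
  have hk0 : (0 : ℝ) ≤ (k : ℕ) := Nat.cast_nonneg _
  have hn : (0 : ℝ) < n + 1 := by positivity
  constructor
  · rw [samplePoint, lt_div_iff₀ hn]; linarith
  · rw [samplePoint, div_lt_iff₀ hn]; linarith

/-- The Bernstein variance measures the distance to k/n; the displacement `e` of the sample point
has e² ≤ 1/n, and (A + e)² ≤ 2A² + 2e². -/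
theorem sq_sub_samplePoint_le {n : ℕ} (hn : n ≠ 0) (k : Fin (n + 1)) (x : ℝ) :
    (x - samplePoint n k) ^ 2 ≤ 8 * ((x + 1) / 2 - (k : ℕ) / n) ^ 2 + 2 / n := by
  have hk : ((k : ℕ) : ℝ) ≤ n := by exact_mod_cast k.is_le
  have hk0 : (0 : ℝ) ≤ (k : ℕ) := Nat.cast_nonneg _
  have hn1 : (1 : ℝ) ≤ n := by exact_mod_cast Nat.one_le_iff_ne_zero.2 hn
  have hn0 : (0 : ℝ) < n := by linarith
  set e : ℝ := (2 * (k : ℕ) - n) / (n * (n + 1)) with he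
  have h1 : x - samplePoint n k = 2 * ((x + 1) / 2 - (k : ℕ) / n) + e := by
    rw [samplePoint, he]; field_simp; ring
  have h2 : e ^ 2 ≤ 1 / n := by
    have h3 : |e| ≤ 1 / n := by
      rw [he, abs_div, abs_of_pos (by positivity : (0 : ℝ) < n * (n + 1)), div_le_div_iff₀
        (by positivity) hn0]
      have : |2 * ((k : ℕ) : ℝ) - n| ≤ n + 1 := abs_le.2 ⟨by linarith, by linarith⟩
      nlinarith
    have h4 : (1 / n : ℝ) ≤ 1 := by rw [div_le_one hn0]; exact hn1
    rw [← sq_abs]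
    nlinarith [abs_nonneg e]
  rw [h1]
  have h5 : (2 / n : ℝ) = 2 * (1 / n) := by ring
  rw [h5]
  nlinarith [sq_nonneg (2 * ((x + 1) / 2 - (k : ℕ) / n) - e)]

/-- Trades the Hölder modulus for a quadratic quantity, which the Bernstein variance controls. -/
theorem sqrt_abs_le {a ε : ℝ} (hε : 0 < ε) : √|a| ≤ ε + a ^ 2 / ε ^ 3 := by
  set s := √|a| with hs
  have hs0 : 0 ≤ s := Real.sqrt_nonneg _
  have h1 : a ^ 2 = s ^ 4 := by
    have : s ^ 2 = |a| := Real.sq_sqrt (abs_nonneg a)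
    rw [← sq_abs, ← this]; ring
  rw [h1]
  rcases le_or_gt s ε with h | h
  · have : 0 ≤ s ^ 4 / ε ^ 3 := by positivity
    linarith
  · have : s ≤ s ^ 4 / ε ^ 3 := by
      rw [le_div_iff₀ (by positivity)]
      have : ε ^ 3 ≤ s ^ 3 := pow_le_pow_left₀ hε.le h.le 3
      nlinarith
    linarith

section

variable {E : Type*} [NormedAddCommGroup E]

/-- `f` is Hölder continuous on `Λ` with exponent `1/2` and constant `K`. -/
def HalfHolder (K : ℝ) (f : ℝ → E) : Prop :=
  ∀ a ∈ dirL, ∀ b ∈ dirL, ‖f a - f b‖ ≤ K * √|a - b|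

theorem HalfHolder.continuousOn {K : ℝ} {f : ℝ → E} (hf : HalfHolder K f) :
    ContinuousOn f dirL := by
  intro a ha
  rw [ContinuousWithinAt, tendsto_iff_norm_sub_tendsto_zero]
  have h : Filter.Tendsto (fun b => K * √|b - a|) (nhdsWithin a dirL) (nhds 0) := by
    have : Continuous fun b : ℝ => K * √|b - a| := by fun_prop
    have h2 := (this.tendsto a).mono_left (nhdsWithin_le_nhds (s := dirL))
    simpa using h2
  refine squeeze_zero' (Filter.Eventually.of_forall fun _ => norm_nonneg _) ?_ h
  filter_upwards [self_mem_nhdsWithin] with b hb using hf b hb a ha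

theorem HalfHolder.integrableOn {K : ℝ} {f : ℝ → E} (hK : 0 ≤ K) (hf : HalfHolder K f) :
    IntegrableOn f dirL := by
  refine Integrable.of_bound (C := ‖f 0‖ + K * √2)
    (hf.continuousOn.aestronglyMeasurable measurableSet_Ioo) ?_
  refine (ae_restrict_iff' measurableSet_Ioo).2 (Filter.Eventually.of_forall fun a ha => ?_)
  have h1 := hf a ha 0 (by norm_num)
  have h2 : √|a - 0| ≤ √2 := by
    refine Real.sqrt_le_sqrt ?_
    rw [sub_zero]
    exact (abs_lt.2 ha).le.trans (by norm_num)
  have h3 := norm_sub_norm_le (f a) (f 0)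
  nlinarith

variable [NormedSpace ℝ E]

/-- Bernstein's argument: average the increments of `f` against the binomial weights. The variance
is at most 1/(4n), so 4/n collects 2/n from the shifted sample points and 8 · 1/(4n). -/
theorem HalfHolder.norm_sub_bernstein_le {K : ℝ} {f : ℝ → E} (hK : 0 ≤ K) (hf : HalfHolder K f)
    {n : ℕ} (hn : n ≠ 0) {ε : ℝ} (hε : 0 < ε) {x : ℝ} (hx : x ∈ dirL) :
    ‖f x - ∑ k : Fin (n + 1), (bernsteinSymm n k).eval x • f (samplePoint n k)‖ ≤
      K * (ε + 4 / n / ε ^ 3) := by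
  have hy := half_add_one_mem_unitInterval hx
  set y : unitInterval := ⟨(x + 1) / 2, hy⟩ with hydef
  have hb : ∀ k : Fin (n + 1), (bernsteinSymm n k).eval x = bernstein n k y :=
    fun k => eval_bernsteinSymm n k hy
  simp only [hb]
  have h1 : f x = ∑ k : Fin (n + 1), bernstein n k y • f x := by
    rw [← Finset.sum_smul, bernstein.probability, one_smul]
  have hvar : ∑ k : Fin (n + 1), ((y : ℝ) - (k : ℕ) / n) ^ 2 * bernstein n k y ≤ 1 / 4 / n := by
    have h := bernstein.variance hn y
    simp only [bernstein.z] at h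
    rw [h]
    gcongr
    nlinarith [sq_nonneg ((y : ℝ) - 1 / 2)]
  have hyx : (x + 1) / 2 = (y : ℝ) := rfl
  calc ‖f x - ∑ k : Fin (n + 1), bernstein n k y • f (samplePoint n k)‖
      = ‖∑ k : Fin (n + 1), bernstein n k y • (f x - f (samplePoint n k))‖ := by
        conv_lhs => rw [h1, ← Finset.sum_sub_distrib]
        simp only [smul_sub]
    _ ≤ ∑ k : Fin (n + 1), bernstein n k y *
          (K * (ε + (8 * ((y : ℝ) - (k : ℕ) / n) ^ 2 + 2 / n) / ε ^ 3)) := by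
        refine norm_sum_le_of_le _ fun k _ => ?_
        rw [norm_smul, Real.norm_of_nonneg bernstein_nonneg]
        refine mul_le_mul_of_nonneg_left ?_ bernstein_nonneg
        refine (hf x hx _ (samplePoint_mem n k)).trans (mul_le_mul_of_nonneg_left ?_ hK)
        refine (sqrt_abs_le hε).trans ?_
        have := sq_sub_samplePoint_le hn k x
        rw [hyx] at this
        gcongr
    _ = K * ((ε + 2 / n / ε ^ 3) * ∑ k : Fin (n + 1), bernstein n k y + 8 / ε ^ 3 *
          ∑ k : Fin (n + 1), ((y : ℝ) - (k : ℕ) / n) ^ 2 * bernstein n k y) := by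
        rw [Finset.mul_sum, Finset.mul_sum, ← Finset.sum_add_distrib, Finset.mul_sum]
        refine Finset.sum_congr rfl fun k _ => ?_
        ring
    _ ≤ K * ((ε + 2 / n / ε ^ 3) * 1 + 8 / ε ^ 3 * (1 / 4 / n)) := by
        rw [bernstein.probability]
        gcongr
    _ = K * (ε + 4 / n / ε ^ 3) := by ring

/-- The rule is exact on the Bernstein approximant. The remainder costs 2 in the sum (positive
weights of total mass 2) and 2 in the integral (length of `Λ`). -/
theorem HalfHolder.norm_quadrature_error_le [CompleteSpace E] {K : ℝ} {f : ℝ → E} (hK : 0 ≤ K)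
    (hf : HalfHolder K f) {n : ℕ} (hn : n ≠ 0) {ε : ℝ} (hε : 0 < ε) {M : ℕ}
    (hM : n ≤ 2 * M + 1) :
    ‖∑ μ ∈ nodes M, weight M μ • f μ - ∫ μ in dirL, f μ‖ ≤ 4 * (K * (ε + 4 / n / ε ^ 3)) := by
  set g : ℝ → E := fun x => ∑ k : Fin (n + 1), (bernsteinSymm n k).eval x • f (samplePoint n k)
    with hg
  set B := K * (ε + 4 / n / ε ^ 3) with hB
  have hfg : ∀ x ∈ dirL, ‖f x - g x‖ ≤ B := fun x hx => hf.norm_sub_bernstein_le hK hn hε hx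
  have hterm : ∀ k : Fin (n + 1), IntegrableOn
      (fun x => (bernsteinSymm n k).eval x • f (samplePoint n k)) dirL := fun k =>
    (((bernsteinSymm n k).continuous.integrableOn_Icc (a := -1) (b := 1)).mono_set
      Ioo_subset_Icc_self).smul_const _
  have hgi : IntegrableOn g dirL := integrable_finsetSum _ fun k _ => hterm k
  have hexact : ∑ μ ∈ nodes M, weight M μ • g μ = ∫ μ in dirL, g μ := by
    rw [hg, integral_finsetSum _ fun k _ => hterm k]
    simp only [Finset.smul_sum]
    rw [Finset.sum_comm]
    refine Finset.sum_congr rfl fun k _ => ?_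
    rw [integral_smul_const, setIntegral_eval,
      ← gauss_exact ((natDegree_bernsteinSymm_le n k).trans hM), Finset.sum_smul]
    exact Finset.sum_congr rfl fun μ _ => smul_smul _ _ _
  have e1 : ‖∑ μ ∈ nodes M, weight M μ • (f μ - g μ)‖ ≤ 2 * B := by
    rw [← sum_weight M, Finset.sum_mul]
    refine norm_sum_le_of_le _ fun μ hμ => ?_
    rw [norm_smul, Real.norm_of_nonneg (weight_pos hμ).le]
    exact mul_le_mul_of_nonneg_left (hfg μ (nodes_subset hμ)) (weight_pos hμ).le
  have e2 : ‖∫ μ in dirL, (f μ - g μ)‖ ≤ B * 2 := by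
    have := norm_setIntegral_le_of_norm_le_const (μ := volume) (s := dirL) (C := B)
      (by simp) hfg
    refine this.trans_eq ?_
    congr 1
    simp [measureReal_def]
    norm_num
  have e3 : ∑ μ ∈ nodes M, weight M μ • f μ - ∫ μ in dirL, f μ =
      ∑ μ ∈ nodes M, weight M μ • (f μ - g μ) - ∫ μ in dirL, (f μ - g μ) := by
    rw [integral_sub (hf.integrableOn hK) hgi, ← hexact]
    simp only [smul_sub, Finset.sum_sub_distrib]
    abel
  rw [e3]
  exact (norm_sub_le _ _).trans (by linarith)

/-- Legendre-Gauss quadrature converges uniformly on the functions which are Hölder continuous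
with a fixed constant. -/
theorem exists_quadrature_error_le (E : Type*) [NormedAddCommGroup E] [NormedSpace ℝ E]
    [CompleteSpace E] {K δ : ℝ} (hK : 0 ≤ K) (hδ : 0 < δ) :
    ∃ M₀ : ℕ, ∀ M ≥ M₀, ∀ f : ℝ → E, HalfHolder K f →
      ‖∑ μ ∈ nodes M, weight M μ • f μ - ∫ μ in dirL, f μ‖ ≤ δ := by
  -- For n > 4/ε⁴ the bound becomes at most 8Kε ≤ δ; `K + 1` avoids dividing by zero.
  set ε := δ / (8 * (K + 1)) with hεdef
  have hε : 0 < ε := by positivity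
  obtain ⟨n, hn⟩ := exists_nat_gt (4 / ε ^ 4)
  have hn0 : (0 : ℝ) < n := lt_trans (by positivity) hn
  refine ⟨n, fun M hM f hf => ?_⟩
  refine (hf.norm_quadrature_error_le hK (n := n) (by rintro rfl; simp at hn0) hε
    (by omega)).trans ?_
  have h1 : 4 / n / ε ^ 3 ≤ ε := by
    rw [div_lt_iff₀ (by positivity)] at hn
    rw [div_div, div_le_iff₀ (by positivity)]
    linarith [show ε * (n * ε ^ 3) = n * ε ^ 4 by ring]
  have h2 : ε * (8 * (K + 1)) = δ := by rw [hεdef]; field_simp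
  nlinarith

end

end NeutronTransport

/-! ### From the Bochner–Sobolev space to Hölder continuity. -/

namespace NeutronTransport

/-! ### Smoothed step functions -/

section Step

variable (φ : ContDiffBump (0 : ℝ))

/-- The primitive of a normalized bump function, a smooth step from `0` to `1`. -/
noncomputable def smoothStep (t : ℝ) : ℝ := ∫ s in Iic t, φ.normed volume s

theorem hasDerivAt_smoothStep (t : ℝ) : HasDerivAt (smoothStep φ) (φ.normed volume t) t := by
  have h : smoothStep φ = fun t => smoothStep φ 0 + ∫ s in (0 : ℝ)..t, φ.normed volume s := by
    ext t
    have := intervalIntegral.integral_Iic_sub_Iic (μ := volume) (f := φ.normed volume) (a := 0)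
      (b := t) φ.integrable_normed.integrableOn φ.integrable_normed.integrableOn
    rw [← this, smoothStep, smoothStep]
    ring
  rw [h]
  exact (intervalIntegral.integral_hasDerivAt_right
    (φ.continuous_normed.intervalIntegrable _ _)
    φ.continuous_normed.stronglyMeasurable.stronglyMeasurableAtFilter
    φ.continuous_normed.continuousAt).const_add _

theorem contDiff_smoothStep : ContDiff ℝ ∞ (smoothStep φ) := by
  rw [contDiff_infty_iff_deriv]
  refine ⟨fun t => (hasDerivAt_smoothStep φ t).differentiableAt, ?_⟩
  rw [show deriv (smoothStep φ) = φ.normed volume from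
    funext fun t => (hasDerivAt_smoothStep φ t).deriv]
  exact φ.contDiff_normed

theorem smoothStep_mem_Icc (t : ℝ) : smoothStep φ t ∈ Icc (0 : ℝ) 1 := by
  refine ⟨setIntegral_nonneg measurableSet_Iic fun s _ => φ.nonneg_normed s, ?_⟩
  rw [← φ.integral_normed (μ := volume)]
  exact setIntegral_le_integral φ.integrable_normed
    (Filter.Eventually.of_forall fun s => φ.nonneg_normed s)

theorem normed_eq_zero {s : ℝ} (h : φ.rOut ≤ |s|) : φ.normed volume s = 0 := by
  rw [← Function.notMem_support, φ.support_normed_eq, mem_ball_zero_iff, Real.norm_eq_abs]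
  exact not_lt.2 h

theorem smoothStep_eq_zero {t : ℝ} (h : t ≤ -φ.rOut) : smoothStep φ t = 0 := by
  refine setIntegral_eq_zero_of_forall_eq_zero fun s hs => normed_eq_zero φ ?_
  have hs' : s ≤ t := hs
  rw [le_abs]
  right
  linarith

theorem smoothStep_eq_one {t : ℝ} (h : φ.rOut ≤ t) : smoothStep φ t = 1 := by
  rw [smoothStep, setIntegral_eq_integral_of_forall_compl_eq_zero, φ.integral_normed]
  intro s hs
  have hs' : t < s := not_le.1 hs
  refine normed_eq_zero φ ?_
  rw [le_abs]
  left
  linarith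

/-- A smoothed indicator function of `[a, b]`. -/
noncomputable def smoothIndicator (a b t : ℝ) : ℝ := smoothStep φ (t - a) - smoothStep φ (t - b)

/-- The derivative is a difference of two mollifiers, so testing a weak derivative with this
function compares the mollified values of `u` at `a` and `b`. -/
theorem deriv_smoothIndicator (a b t : ℝ) :
    deriv (smoothIndicator φ a b) t = φ.normed volume (t - a) - φ.normed volume (t - b) :=
  (((hasDerivAt_smoothStep φ (t - a)).comp_sub_const t a).sub
    ((hasDerivAt_smoothStep φ (t - b)).comp_sub_const t b)).deriv

theorem abs_smoothIndicator_le_one (a b t : ℝ) : |smoothIndicator φ a b t| ≤ 1 := by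
  have h1 := smoothStep_mem_Icc φ (t - a)
  have h2 := smoothStep_mem_Icc φ (t - b)
  rw [smoothIndicator, abs_le]
  constructor <;> linarith [h1.1, h1.2, h2.1, h2.2]

theorem smoothIndicator_eq_zero {a b t : ℝ} (hab : a ≤ b)
    (ht : t ∉ Icc (a - φ.rOut) (b + φ.rOut)) : smoothIndicator φ a b t = 0 := by
  rw [mem_Icc, not_and_or, not_le, not_le] at ht
  rw [smoothIndicator]
  rcases ht with h | h
  · rw [smoothStep_eq_zero φ (by linarith), smoothStep_eq_zero φ (by linarith), sub_zero]
  · rw [smoothStep_eq_one φ (by linarith), smoothStep_eq_one φ (by linarith), sub_self]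

theorem isTest_smoothIndicator {a b : ℝ} (hab : a ≤ b) (ha : -1 < a - φ.rOut)
    (hb : b + φ.rOut < 1) : IsTest (smoothIndicator φ a b) := by
  have hsupp : tsupport (smoothIndicator φ a b) ⊆ Icc (a - φ.rOut) (b + φ.rOut) := by
    refine closure_minimal (fun t ht => ?_) isClosed_Icc
    by_contra h
    exact ht (smoothIndicator_eq_zero φ hab h)
  refine ⟨?_, isCompact_Icc.of_isClosed_subset (isClosed_tsupport _) hsupp,
    hsupp.trans (Icc_subset_Ioo ha hb)⟩
  exact ((contDiff_smoothStep φ).comp (contDiff_id.sub contDiff_const)).sub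
    ((contDiff_smoothStep φ).comp (contDiff_id.sub contDiff_const))

end Step

/-! ### Hölder continuity of functions in `H¹(Λ; X)` -/

theorem ae_restrict_le_imp_le {f g : ℝ → ℝ} (hf : ContinuousOn f dirL) (hg : ContinuousOn g dirL)
    (h : ∀ᵐ x ∂(volume.restrict dirL), f x ≤ g x) : ∀ x ∈ dirL, f x ≤ g x := by
  have h1 : (fun x => max (f x) (g x)) =ᵐ[volume.restrict dirL] g := by
    filter_upwards [h] with x hx using max_eq_right hx
  intro x hx
  exact max_eq_right_iff.1
    (Measure.eqOn_open_of_ae_eq h1 isOpen_Ioo (hf.sup hg) hg hx)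

section HalfHolder

variable {X : Type*} [NormedAddCommGroup X]

/-- Cauchy–Schwarz; the square root of the measure is the source of the Hölder exponent 1/2. -/
theorem setIntegral_norm_le_sqrt_mul {α : Type*} [MeasurableSpace α] {m : Measure α}
    [IsFiniteMeasure m] (w : Lp X 2 m) (S : Set α) :
    ∫ t in S, ‖w t‖ ∂m ≤ √(m.real S) * ‖w‖ := by
  have h2 : eLpNorm w 1 (m.restrict S) ≤ eLpNorm w 2 m * m S ^ (1 / 2 : ℝ) := by
    have := eLpNorm_le_eLpNorm_mul_rpow_measure_univ (p := 1) (q := 2) (μ := m.restrict S)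
      (by norm_num) (Lp.aestronglyMeasurable w).restrict
    norm_num at this ⊢
    exact this.trans (mul_le_mul_left (eLpNorm_mono_measure _ Measure.restrict_le_self) _)
  rw [integral_norm_eq_lintegral_enorm (Lp.aestronglyMeasurable w).restrict,
    ← eLpNorm_one_eq_lintegral_enorm, Lp.norm_def, Real.sqrt_eq_rpow, measureReal_def,
    ENNReal.toReal_rpow, ← ENNReal.toReal_mul, mul_comm]
  refine ENNReal.toReal_mono (ENNReal.mul_ne_top (Lp.eLpNorm_ne_top w) ?_) h2
  exact ENNReal.rpow_ne_top_of_nonneg (by norm_num) (measure_ne_top _ _)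

variable [NormedSpace ℝ X]

/-- A mollified fundamental theorem of calculus: the increment is an integral of `w` over an
interval of length `b - a + 2 * φ.rOut`. -/
theorem IsWeakDeriv.norm_integral_normed_sub_le {u w : Lp X 2 (volume.restrict dirL)}
    (h : IsWeakDeriv (u : ℝ → X) w) (φ : ContDiffBump (0 : ℝ)) {a b : ℝ} (hab : a ≤ b)
    (ha : -1 < a - φ.rOut) (hb : b + φ.rOut < 1) :
    ‖(∫ t in dirL, φ.normed volume (t - a) • u t) - ∫ t in dirL, φ.normed volume (t - b) • u t‖ ≤
      √(b - a + 2 * φ.rOut) * ‖w‖ := by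
  have hu : Integrable (u : ℝ → X) (volume.restrict dirL) := (Lp.memLp u).integrable (by norm_num)
  have hw : Integrable (w : ℝ → X) (volume.restrict dirL) := (Lp.memLp w).integrable (by norm_num)
  have hint : ∀ c, Integrable (fun t => φ.normed volume (t - c) • u t) (volume.restrict dirL) := by
    intro c
    obtain ⟨C, hC⟩ := φ.hasCompactSupport_normed.exists_bound_of_continuous
      (φ.continuous_normed (μ := volume))
    exact hu.bdd_smul C (φ.continuous_normed.comp (continuous_sub_right c)).aestronglyMeasurable
      (Filter.Eventually.of_forall fun t => hC _)
  rw [← integral_sub (hint a) (hint b)]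
  have h1 := h _ (isTest_smoothIndicator φ hab ha hb)
  simp only [deriv_smoothIndicator, sub_smul] at h1
  rw [h1, norm_neg]
  set S := Icc (a - φ.rOut) (b + φ.rOut) with hS
  have hvol : (volume.restrict dirL).real S ≤ b - a + 2 * φ.rOut := by
    refine (ENNReal.toReal_mono (by simp [hS]) (Measure.restrict_apply_le _ _)).trans_eq ?_
    rw [hS, ← measureReal_def, Real.volume_real_Icc_of_le (by linarith [φ.rOut_pos])]
    ring
  calc ‖∫ t in dirL, smoothIndicator φ a b t • w t‖
      ≤ ∫ t in dirL, S.indicator (fun t => ‖w t‖) t := by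
        refine norm_integral_le_of_norm_le (hw.norm.indicator measurableSet_Icc)
          (Filter.Eventually.of_forall fun t => ?_)
        rw [norm_smul]
        by_cases ht : t ∈ S
        · rw [indicator_of_mem ht]
          exact mul_le_of_le_one_left (norm_nonneg _) (abs_smoothIndicator_le_one φ a b t)
        · rw [indicator_of_notMem ht, smoothIndicator_eq_zero φ hab ht, norm_zero, zero_mul]
    _ = ∫ t in S, ‖w t‖ ∂(volume.restrict dirL) := integral_indicator measurableSet_Icc
    _ ≤ _ := setIntegral_norm_le_sqrt_mul w S
    _ ≤ _ := mul_le_mul_of_nonneg_right (Real.sqrt_le_sqrt hvol) (norm_nonneg _)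

theorem evalH1_sub_ae (u v : H1 X) : ∀ᵐ t ∂(volume.restrict dirL),
    evalH1 (u - v) t = evalH1 u t - evalH1 v t :=
  Lp.coeFn_sub u.1.fst v.1.fst

variable [CompleteSpace X]

theorem exists_ae_tendsto_normed (u : Lp X 2 (volume.restrict dirL)) :
    ∃ φ : ℕ → ContDiffBump (0 : ℝ), Filter.Tendsto (fun i => (φ i).rOut) Filter.atTop (nhds 0) ∧
      ∀ᵐ a ∂(volume.restrict dirL), Filter.Tendsto
        (fun i => ∫ t in dirL, (φ i).normed volume (t - a) • u t) Filter.atTop (nhds (u a)) := by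
  let φ : ℕ → ContDiffBump (0 : ℝ) := fun i =>
    -- The ratio of the radii stays fixed at 2, as the Lebesgue differentiation theorem for bump
    -- functions demands a bounded ratio.
    { rIn := 1 / ((i : ℝ) + 1)
      rOut := 2 * (1 / ((i : ℝ) + 1))
      rIn_pos := by positivity
      rIn_lt_rOut := by
        have : (0 : ℝ) < 1 / ((i : ℝ) + 1) := by positivity
        linarith }
  have hφ : Filter.Tendsto (fun i => (φ i).rOut) Filter.atTop (nhds 0) := by
    simpa [φ] using (tendsto_one_div_add_atTop_nhds_zero_nat (𝕜 := ℝ)).const_mul 2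
  refine ⟨φ, hφ, ?_⟩
  have hu : Integrable (u : ℝ → X) (volume.restrict dirL) := (Lp.memLp u).integrable (by norm_num)
  have hg : LocallyIntegrable (dirL.indicator (u : ℝ → X)) volume :=
    ((integrable_indicator_iff measurableSet_Ioo).2 hu).locallyIntegrable
  have h := ContDiffBump.ae_convolution_tendsto_right_of_locallyIntegrable (K := 2) hφ
    (Filter.Eventually.of_forall fun i => le_rfl) hg
  rw [ae_restrict_iff' measurableSet_Ioo]
  filter_upwards [h] with a ha hmem
  rw [indicator_of_mem hmem] at ha
  refine ha.congr fun i => ?_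
  rw [convolution_eq_swap, ← integral_indicator measurableSet_Ioo]
  refine integral_congr_ae (Filter.Eventually.of_forall fun t => ?_)
  simp only [ContinuousLinearMap.lsmul_apply]
  rw [← (φ i).normed_neg (μ := volume) (a - t), neg_sub]
  by_cases ht : t ∈ dirL
  · rw [indicator_of_mem ht, indicator_of_mem ht]
  · rw [indicator_of_notMem ht, indicator_of_notMem ht, smul_zero]

/-- Let the mollification radius tend to zero at the points where the mollified values converge to
`u`. A single full-measure set `G` serves both points, so no continuous representative has to be
constructed. -/
theorem H1.exists_ae_norm_sub_le (u : H1 X) :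
    ∃ G : Set ℝ, (∀ᵐ a ∂(volume.restrict dirL), a ∈ G) ∧
      ∀ a ∈ G, ∀ b ∈ G, ‖evalH1 u a - evalH1 u b‖ ≤ ‖u‖ * √|a - b| := by
  obtain ⟨φ, hφ, hlim⟩ := exists_ae_tendsto_normed u.1.fst
  refine ⟨{a | a ∈ dirL ∧ Filter.Tendsto (fun i => ∫ t in dirL,
    (φ i).normed volume (t - a) • u.1.fst t) Filter.atTop (nhds (u.1.fst a))}, ?_, ?_⟩
  · filter_upwards [hlim, ae_restrict_mem measurableSet_Ioo] with a h1 h2 using ⟨h2, h1⟩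
  have key : ∀ a ∈ dirL, ∀ b ∈ dirL, a ≤ b →
      Filter.Tendsto (fun i => ∫ t in dirL, (φ i).normed volume (t - a) • u.1.fst t)
        Filter.atTop (nhds (u.1.fst a)) →
      Filter.Tendsto (fun i => ∫ t in dirL, (φ i).normed volume (t - b) • u.1.fst t)
        Filter.atTop (nhds (u.1.fst b)) →
      ‖evalH1 u a - evalH1 u b‖ ≤ ‖u‖ * √|a - b| := by
    intro a ha b hb hab hta htb
    have h1 : Filter.Tendsto (fun i => √(b - a + 2 * (φ i).rOut) * ‖u.1.snd‖) Filter.atTop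
        (nhds (√(b - a + 2 * 0) * ‖u.1.snd‖)) :=
      ((Real.continuous_sqrt.tendsto _).comp ((hφ.const_mul 2).const_add _)).mul_const _
    have h2 : ‖evalH1 u a - evalH1 u b‖ ≤ √(b - a + 2 * 0) * ‖u.1.snd‖ := by
      refine le_of_tendsto_of_tendsto (hta.sub htb).norm h1 ?_
      filter_upwards [hφ.eventually_lt_const (show 0 < a + 1 by linarith [ha.1]),
        hφ.eventually_lt_const (show 0 < 1 - b by linarith [hb.2])] with i h3 h4
      exact IsWeakDeriv.norm_integral_normed_sub_le u.2 (φ i) hab (by linarith) (by linarith)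
    refine h2.trans ?_
    rw [mul_zero, add_zero, abs_sub_comm, abs_of_nonneg (sub_nonneg.2 hab), mul_comm]
    exact mul_le_mul_of_nonneg_right (WithLp.norm_snd_le _ u.1) (Real.sqrt_nonneg _)
  rintro a ⟨ha, hta⟩ b ⟨hb, htb⟩
  rcases le_total a b with hab | hab
  · exact key a ha b hb hab hta htb
  · rw [norm_sub_rev, abs_sub_comm]
    exact key b hb a ha hab htb hta

/-- Average ‖u(a)‖ ≤ ‖u(b)‖ + ‖u‖ √|a - b| over `b`. The constant 4 is not sharp. -/
theorem H1.ae_norm_le (u : H1 X) : ∀ᵐ a ∂(volume.restrict dirL), ‖evalH1 u a‖ ≤ 4 * ‖u‖ := by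
  obtain ⟨G, hG, h⟩ := H1.exists_ae_norm_sub_le u
  have hu : Integrable (u.1.fst : ℝ → X) (volume.restrict dirL) :=
    (Lp.memLp u.1.fst).integrable (by norm_num)
  have hvol : (volume.restrict dirL).real univ = 2 := by
    simp [measureReal_def]
    norm_num
  have hs : √2 ≤ 2 := by
    rw [Real.sqrt_le_left (by norm_num)]; norm_num
  filter_upwards [hG, ae_restrict_mem measurableSet_Ioo] with a ha hmem
  have h1 : ∫ b in dirL, ‖evalH1 u a‖ ≤ ∫ b in dirL, (‖u.1.fst b‖ + ‖u‖ * 2) := by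
    refine integral_mono_ae (integrable_const _) (hu.norm.add (integrable_const _)) ?_
    filter_upwards [hG, ae_restrict_mem measurableSet_Ioo] with b hb hmemb
    have h2 := h a ha b hb
    have h3 : √|a - b| ≤ 2 := by
      refine (Real.sqrt_le_sqrt (?_ : |a - b| ≤ 2)).trans hs
      rw [abs_le]
      constructor <;> linarith [hmem.1, hmem.2, hmemb.1, hmemb.2]
    have h4 := norm_sub_norm_le (evalH1 u a) (evalH1 u b)
    have h5 := mul_le_mul_of_nonneg_left h3 (norm_nonneg u)
    have h6 : ‖evalH1 u b‖ = ‖u.1.fst b‖ := rfl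
    linarith
  rw [integral_add hu.norm (integrable_const _), integral_const, integral_const, hvol] at h1
  have h7 := setIntegral_norm_le_sqrt_mul u.1.fst univ
  rw [Measure.restrict_univ, hvol] at h7
  have h8 : ‖u.1.fst‖ ≤ ‖u‖ := WithLp.norm_fst_le _ u.1
  have h9 := mul_le_mul hs h8 (norm_nonneg _) zero_le_two
  simp only [smul_eq_mul] at h1
  linarith [norm_nonneg u]

theorem H1.ae_norm_sub_le (u v : H1 X) :
    ∀ᵐ a ∂(volume.restrict dirL), ‖evalH1 u a - evalH1 v a‖ ≤ 4 * ‖u - v‖ := by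
  filter_upwards [H1.ae_norm_le (u - v), evalH1_sub_ae u v] with a h1 h2
  rwa [h2] at h1

/-- In `ν`, the increment of `σ` is bounded by the essential supremum of `T a - T b`, hence by `4 *
‖T a - T b‖`; in `μ`, the Hölder constant is `‖T ν‖`. Joint continuity of `σ` upgrades each
almost-everywhere bound to all directions, one variable at a time. -/
theorem halfHolder_of_ae_eq_evalH1 {σ : ℝ → ℝ → X}
    (hc : ContinuousOn (fun p : ℝ × ℝ => σ p.1 p.2) (dirL ×ˢ dirL)) {T : ℝ → H1 X}
    (hT : ∀ᵐ ν ∂(volume.restrict dirL), ∀ᵐ μ ∂(volume.restrict dirL), σ ν μ = evalH1 (T ν) μ)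
    {C : ℝ} {G : Set ℝ} (hG : ∀ᵐ a ∂(volume.restrict dirL), a ∈ G)
    (hGle : ∀ a ∈ G, ∀ b ∈ G, ‖T a - T b‖ ≤ C * √|a - b|)
    (hle : ∀ᵐ a ∂(volume.restrict dirL), ‖T a‖ ≤ 4 * C) :
    (∀ μ ∈ dirL, HalfHolder (4 * C) fun ν => σ ν μ) ∧ ∀ ν ∈ dirL, HalfHolder (4 * C) (σ ν) := by
  have hcν : ∀ μ ∈ dirL, ContinuousOn (fun ν => σ ν μ) dirL := fun μ hμ =>
    hc.comp (f := fun ν => (ν, μ)) (by fun_prop) fun ν hν => ⟨hν, hμ⟩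
  have hcμ : ∀ ν ∈ dirL, ContinuousOn (σ ν) dirL := fun ν hν =>
    hc.comp (f := fun μ => (ν, μ)) (by fun_prop) fun μ hμ => ⟨hν, hμ⟩
  have hsqrt : ∀ a : ℝ, ContinuousOn (fun b => 4 * C * √|a - b|) dirL := fun a => by fun_prop
  have hsqrt' : ∀ b : ℝ, ContinuousOn (fun a => 4 * C * √|a - b|) dirL := fun b => by fun_prop
  refine ⟨fun μ hμ => ?_, fun ν hν => ?_⟩
  · have h1 : ∀ᵐ a ∂(volume.restrict dirL), ∀ b ∈ dirL, ‖σ a μ - σ b μ‖ ≤ 4 * C * √|a - b| := by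
      filter_upwards [hG, hT, ae_restrict_mem measurableSet_Ioo] with a ha haT hmema
      refine ae_restrict_le_imp_le (continuousOn_const.sub (hcν μ hμ)).norm (hsqrt a) ?_
      filter_upwards [hG, hT, ae_restrict_mem measurableSet_Ioo] with b hb hbT hmemb
      refine ae_restrict_le_imp_le ((hcμ a hmema).sub (hcμ b hmemb)).norm continuousOn_const ?_ μ hμ
      filter_upwards [haT, hbT, H1.ae_norm_sub_le (T a) (T b)] with t h1 h2 h3
      rw [Pi.sub_apply, h1, h2, mul_assoc]
      exact h3.trans (mul_le_mul_of_nonneg_left (hGle a ha b hb) (by norm_num))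
    intro a ha b hb
    refine ae_restrict_le_imp_le ((hcν μ hμ).sub continuousOn_const).norm (hsqrt' b) ?_ a ha
    filter_upwards [h1] with a ha using ha b hb
  · intro a ha b hb
    refine ae_restrict_le_imp_le ((hcν a ha).sub (hcν b hb)).norm continuousOn_const ?_ ν hν
    filter_upwards [hT, hle, ae_restrict_mem measurableSet_Ioo] with ν h1 h2 hν
    obtain ⟨G', hG', hGle'⟩ := H1.exists_ae_norm_sub_le (T ν)
    have h3 : ∀ᵐ a ∂(volume.restrict dirL), ∀ b ∈ dirL, ‖σ ν a - σ ν b‖ ≤ 4 * C * √|a - b| := by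
      filter_upwards [hG', h1] with a ha ha'
      refine ae_restrict_le_imp_le (continuousOn_const.sub (hcμ ν hν)).norm (hsqrt a) ?_
      filter_upwards [hG', h1] with b hb hb'
      rw [ha', hb']
      exact (hGle' a ha b hb).trans (mul_le_mul_of_nonneg_right h2 (Real.sqrt_nonneg _))
    refine ae_restrict_le_imp_le ((hcμ ν hν).sub continuousOn_const).norm (hsqrt' b) ?_ a ha
    filter_upwards [h3] with a ha using ha b hb

end HalfHolder

theorem MemH1H1.exists_halfHolder {σ : ℝ → ℝ → LInfD} (h : MemH1H1 σ) :
    ∃ K : ℝ, 0 ≤ K ∧ (∀ μ ∈ dirL, HalfHolder K fun ν => σ ν μ) ∧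
      ∀ ν ∈ dirL, HalfHolder K (σ ν) := by
  obtain ⟨hc, S, hS⟩ := h
  obtain ⟨G, hG, hGle⟩ := H1.exists_ae_norm_sub_le S
  exact ⟨4 * ‖S‖, by positivity,
    halfHolder_of_ae_eq_evalH1 hc hS hG hGle (H1.ae_norm_le S)⟩

end NeutronTransport

/-! ### Coercivity of the discrete transport form. -/

namespace NeutronTransport

/-! ### The inner product of `L²(D)` against polynomials -/

theorem integrable_mul_eval {f : ℝ → ℝ} (hf : Integrable f (volume.restrict spaceD)) (p : ℝ[X]) :
    Integrable (fun x => f x * p.eval x) (volume.restrict spaceD) := by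
  obtain ⟨K, hK⟩ := isCompact_Icc.exists_bound_of_continuousOn
    (p.continuous.continuousOn (s := Icc (-1 : ℝ) 1))
  refine hf.mul_bdd (c := K) p.continuous.aestronglyMeasurable ?_
  filter_upwards [ae_restrict_mem measurableSet_Ioo] with x hx using hK x (Ioo_subset_Icc_self hx)

theorem integrable_LInfD (f : LInfD) : Integrable f (volume.restrict spaceD) :=
  (Lp.memLp f).integrable le_top

theorem integrable_eval (p : ℝ[X]) : Integrable (fun x => p.eval x) (volume.restrict spaceD) := by
  simpa using integrable_mul_eval (integrable_const (1 : ℝ)) p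

theorem innerD_eval (p q : ℝ[X]) :
    innerD (fun x => p.eval x) (fun x => q.eval x) = polyInt (p * q) := by
  rw [innerD, ← setIntegral_eval]
  simp only [eval_mul]

theorem innerD_add_left {f g : ℝ → ℝ} (hf : Integrable f (volume.restrict spaceD))
    (hg : Integrable g (volume.restrict spaceD)) (p : ℝ[X]) :
    innerD (fun x => f x + g x) (fun x => p.eval x) =
      innerD f (fun x => p.eval x) + innerD g (fun x => p.eval x) := by
  simp only [innerD, add_mul]
  exact integral_add (integrable_mul_eval hf p) (integrable_mul_eval hg p)

theorem innerD_smul_left (a : ℝ) (f g : ℝ → ℝ) :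
    innerD (fun x => a * f x) g = a * innerD f g := by
  simp only [innerD, mul_assoc]
  exact integral_const_mul _ _

theorem innerD_add_right {f : ℝ → ℝ} (hf : Integrable f (volume.restrict spaceD)) (p q : ℝ[X]) :
    innerD f (fun x => (p + q).eval x) =
      innerD f (fun x => p.eval x) + innerD f (fun x => q.eval x) := by
  simp only [innerD, eval_add, mul_add]
  exact integral_add (integrable_mul_eval hf p) (integrable_mul_eval hf q)

theorem innerD_smul_right (a : ℝ) (f : ℝ → ℝ) (p : ℝ[X]) :
    innerD f (fun x => (a • p).eval x) = a * innerD f (fun x => p.eval x) := by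
  simp only [innerD, eval_smul, smul_eq_mul, mul_left_comm]
  exact integral_const_mul _ _

theorem innerD_zero_right (f : ℝ → ℝ) : innerD f (fun x => (0 : ℝ[X]).eval x) = 0 := by
  simp [innerD]

/-! ### The discrete operator -/

section Operator

variable (M : ℕ) (sigT : ℝ → LInfD) (sigS : ℝ → ℝ → LInfD)

theorem integrable_opLM (φ : ℝ[X][Y]) (μ : ℝ) :
    Integrable (fun x => opLM M sigT sigS φ x μ) (volume.restrict spaceD) := by
  refine Integrable.sub (Integrable.add ((integrable_eval _).const_mul μ)
    (integrable_mul_eval (integrable_LInfD _) (φ.eval (C μ)))) (Integrable.const_mul ?_ _)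
  refine integrable_finsetSum _ fun ν _ => ?_
  exact integrable_mul_eval ((integrable_LInfD (sigS ν μ)).const_mul (weight M ν)) (φ.eval (C ν))

theorem opLM_add (φ ψ : ℝ[X][Y]) (x μ : ℝ) :
    opLM M sigT sigS (φ + ψ) x μ = opLM M sigT sigS φ x μ + opLM M sigT sigS ψ x μ := by
  simp only [opLM, evalEval, eval_add, derivative_add, mul_add, Finset.sum_add_distrib]
  ring

theorem opLM_smul (a : ℝ) (φ : ℝ[X][Y]) (x μ : ℝ) :
    opLM M sigT sigS (a • φ) x μ = a * opLM M sigT sigS φ x μ := by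
  have h : ∀ ν : ℝ, (a • φ).eval (C ν) = a • φ.eval (C ν) := fun ν => eval_smul _ _ _
  simp only [opLM, evalEval, h, derivative_smul, eval_smul, smul_eq_mul]
  have h2 : ∑ ν ∈ nodes M, weight M ν * sigS ν μ x * (a * (φ.eval (C ν)).eval x) =
      a * ∑ ν ∈ nodes M, weight M ν * sigS ν μ x * (φ.eval (C ν)).eval x := by
    rw [Finset.mul_sum]
    exact Finset.sum_congr rfl fun ν _ => by ring
  rw [h2]
  ring

theorem innerD_opLM_add (φ ψ : ℝ[X][Y]) (μ : ℝ) (p : ℝ[X]) :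
    innerD (fun x => opLM M sigT sigS (φ + ψ) x μ) (fun x => p.eval x) =
      innerD (fun x => opLM M sigT sigS φ x μ) (fun x => p.eval x) +
        innerD (fun x => opLM M sigT sigS ψ x μ) (fun x => p.eval x) := by
  rw [← innerD_add_left (integrable_opLM M sigT sigS φ μ) (integrable_opLM M sigT sigS ψ μ)]
  simp only [opLM_add]

theorem innerD_opLM_smul (a : ℝ) (φ : ℝ[X][Y]) (μ : ℝ) (p : ℝ[X]) :
    innerD (fun x => opLM M sigT sigS (a • φ) x μ) (fun x => p.eval x) =
      a * innerD (fun x => opLM M sigT sigS φ x μ) (fun x => p.eval x) := by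
  rw [← innerD_smul_left]
  simp only [opLM_smul]

end Operator

/-! ### The norm -/

/-- The integral over `D` of a polynomial in `x` and `μ`, a polynomial in `μ`. -/
noncomputable def partialInt (ψ : ℝ[X][Y]) : ℝ[X] :=
  ∑ j ∈ Finset.range (ψ.natDegree + 1), C (polyInt (ψ.coeff j)) * X ^ j

theorem eval_partialInt (ψ : ℝ[X][Y]) (μ : ℝ) :
    (partialInt ψ).eval μ = polyInt (ψ.eval (C μ)) := by
  rw [partialInt, eval_finsetSum, eval_eq_sum_range, map_sum]
  refine Finset.sum_congr rfl fun j _ => ?_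
  rw [← C_pow, mul_comm (ψ.coeff j), polyInt_C_mul, eval_mul, eval_C, eval_pow, eval_X, mul_comm]

theorem natDegree_partialInt_le (ψ : ℝ[X][Y]) : (partialInt ψ).natDegree ≤ ψ.natDegree := by
  refine natDegree_sum_le_of_forall_le _ _ fun j hj => ?_
  exact (natDegree_C_mul_X_pow_le _ _).trans (Nat.lt_succ_iff.1 (Finset.mem_range.1 hj))

/-- After integration over `D`, the square of `φ` is a polynomial of degree at most `2 * M` in `μ`,
so Gauss quadrature computes the norm exactly. -/
theorem tripleNorm_sq {M N : ℕ} {φ : ℝ[X][Y]} (hφ : φ ∈ trialSpace M N) :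
    tripleNorm (fun x μ => φ.evalEval x μ) ^ 2 =
      ∑ μ ∈ nodes M, weight M μ * polyInt (φ.eval (C μ) * φ.eval (C μ)) := by
  have hint : ∫ μ in dirL, innerD (fun x => φ.evalEval x μ) (fun x => φ.evalEval x μ) =
      ∑ μ ∈ nodes M, weight M μ * polyInt (φ.eval (C μ) * φ.eval (C μ)) := by
    have h1 : ∀ μ : ℝ, innerD (fun x => φ.evalEval x μ) (fun x => φ.evalEval x μ) =
        (partialInt (φ * φ)).eval μ := fun μ => by
      rw [eval_partialInt, eval_mul]
      exact innerD_eval _ _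
    simp only [h1]
    rw [setIntegral_eval, ← gauss_exact (M := M)]
    · simp only [eval_partialInt, eval_mul]
    · refine (natDegree_partialInt_le _).trans (natDegree_mul_le.trans ?_)
      have := hφ.1
      omega
  rw [tripleNorm, Real.sq_sqrt, hint]
  rw [hint]
  exact Finset.sum_nonneg fun μ hμ => mul_nonneg (weight_pos hμ).le (polyInt_sq_nonneg _)

/-! ### Coercivity -/

/-- Young's inequality splits 2 p_m p_i into p_m² + p_i², producing one sum over incoming and one
over outgoing directions. As `σ` need not be symmetric, each is absorbed by its own condition, and
the two bounds are averaged. -/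
theorem sum_scattering_le {s : Finset ℝ} {w T p : ℝ → ℝ} {σ : ℝ → ℝ → ℝ} {c : ℝ}
    (hw : ∀ i ∈ s, 0 ≤ w i) (hσ : ∀ i ∈ s, ∀ m ∈ s, 0 ≤ σ i m)
    (h₁ : ∀ m ∈ s, c ≤ T m - 1 / 2 * ∑ i ∈ s, w i * σ i m)
    (h₂ : ∀ i ∈ s, c ≤ T i - 1 / 2 * ∑ m ∈ s, w m * σ i m) :
    c * ∑ m ∈ s, w m * p m ^ 2 ≤
      ∑ m ∈ s, w m * ((T m * p m - 1 / 2 * ∑ i ∈ s, w i * σ i m * p i) * p m) := by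
  have h3 : ∑ m ∈ s, ∑ i ∈ s, w m * (w i * σ i m * p i * p m) ≤
      ∑ m ∈ s, ∑ i ∈ s, (1 / 2 * (w m * w i * σ i m * p m ^ 2) +
        1 / 2 * (w m * w i * σ i m * p i ^ 2)) := by
    refine Finset.sum_le_sum fun m hm => Finset.sum_le_sum fun i hi => ?_
    have := mul_nonneg (mul_nonneg (hw m hm) (hw i hi)) (hσ i hi m hm)
    nlinarith [mul_nonneg this (sq_nonneg (p m - p i))]
  have h4 : ∑ m ∈ s, ∑ i ∈ s, (1 / 2 * (w m * w i * σ i m * p m ^ 2) +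
        1 / 2 * (w m * w i * σ i m * p i ^ 2)) =
      ∑ m ∈ s, w m * p m ^ 2 * (1 / 2 * ∑ i ∈ s, w i * σ i m) +
        ∑ i ∈ s, w i * p i ^ 2 * (1 / 2 * ∑ m ∈ s, w m * σ i m) := by
    simp only [Finset.sum_add_distrib]
    congr 1
    · refine Finset.sum_congr rfl fun m _ => ?_
      rw [Finset.mul_sum, Finset.mul_sum]
      exact Finset.sum_congr rfl fun i _ => by ring
    · rw [Finset.sum_comm]
      refine Finset.sum_congr rfl fun m _ => ?_
      rw [Finset.mul_sum, Finset.mul_sum]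
      exact Finset.sum_congr rfl fun i _ => by ring
  have h5 : ∑ m ∈ s, w m * ((T m * p m - 1 / 2 * ∑ i ∈ s, w i * σ i m * p i) * p m) =
      ∑ m ∈ s, w m * p m ^ 2 * T m -
        1 / 2 * ∑ m ∈ s, ∑ i ∈ s, w m * (w i * σ i m * p i * p m) := by
    rw [Finset.mul_sum, ← Finset.sum_sub_distrib]
    refine Finset.sum_congr rfl fun m _ => ?_
    rw [← Finset.mul_sum, ← Finset.sum_mul]
    ring
  have h6 : c * ∑ m ∈ s, w m * p m ^ 2 ≤
      ∑ m ∈ s, w m * p m ^ 2 * T m - ∑ m ∈ s, w m * p m ^ 2 * (1 / 2 * ∑ i ∈ s, w i * σ i m) := by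
    rw [Finset.mul_sum, ← Finset.sum_sub_distrib]
    refine Finset.sum_le_sum fun m hm => ?_
    nlinarith [h₁ m hm, mul_nonneg (hw m hm) (sq_nonneg (p m))]
  have h7 : c * ∑ m ∈ s, w m * p m ^ 2 ≤
      ∑ m ∈ s, w m * p m ^ 2 * T m - ∑ i ∈ s, w i * p i ^ 2 * (1 / 2 * ∑ m ∈ s, w m * σ i m) := by
    rw [Finset.mul_sum, ← Finset.sum_sub_distrib]
    refine Finset.sum_le_sum fun m hm => ?_
    nlinarith [h₂ m hm, mul_nonneg (hw m hm) (sq_nonneg (p m))]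
  rw [h5]
  linarith

theorem ae_le_of_norm_sub_le {f g : LInfD} {c : ℝ} (h : ‖f - g‖ ≤ c) :
    ∀ᵐ x ∂(volume.restrict spaceD), f x ≤ g x + c := by
  have h1 : ∀ᵐ x ∂(volume.restrict spaceD), ‖(f - g : LInfD) x‖ₑ ≤ eLpNorm (f - g : LInfD) ∞ _ :=
    ae_le_eLpNormEssSup
  filter_upwards [h1, Lp.coeFn_sub f g] with x h2 h3
  have h4 := ENNReal.toReal_mono (Lp.eLpNorm_ne_top _) h2
  rw [toReal_enorm, ← Lp.norm_def, h3, Pi.sub_apply, Real.norm_eq_abs] at h4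
  linarith [(abs_le.1 (h4.trans h)).2]

theorem coeFn_sum_smul_ae (s : Finset ℝ) (w : ℝ → ℝ) (f : ℝ → LInfD) :
    ∀ᵐ x ∂(volume.restrict spaceD),
      (∑ i ∈ s, w i • f i : LInfD) x = ∑ i ∈ s, w i * f i x := by
  have h : ∀ᵐ x ∂(volume.restrict spaceD), ∀ i ∈ s, (w i • f i : LInfD) x = w i * f i x := by
    refine (ae_ball_iff s.countable_toSet).2 fun i _ => ?_
    filter_upwards [Lp.coeFn_smul (w i) (f i)] with x hx
    rw [hx, Pi.smul_apply, smul_eq_mul]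
  filter_upwards [h, Lp.coeFn_finsetSum s fun i => w i • f i] with x h1 h2
  rw [h2, Finset.sum_apply]
  exact Finset.sum_congr rfl fun i hi => h1 i hi

/-- The integral of p' p is half the jump of p²; the inflow value vanishes, and the sign of `μ`
makes the outflow contribution nonnegative. -/
theorem mul_polyInt_derivative {N : ℕ} {μ : ℝ} {p : ℝ[X]} (hp : p ∈ nodalSpace N μ) :
    μ * polyInt (derivative p * p) = 1 / 2 * (|μ| * p.eval (Real.sign μ) ^ 2) := by
  have h := polyInt_derivative_mul p p
  rw [mul_comm p (derivative p)] at h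
  rcases lt_trichotomy μ 0 with h0 | rfl | h0
  · rw [hp.2.2 h0] at h
    rw [Real.sign_of_neg h0, abs_of_neg h0]
    linear_combination μ / 2 * h
  · simp
  · rw [hp.2.1 h0] at h
    rw [Real.sign_of_pos h0, abs_of_pos h0]
    linear_combination μ / 2 * h

/-- The bounds at the nodes which give coercivity: subcriticality for the quadrature sums. -/
structure NodalSubcritical (M : ℕ) (sigT : ℝ → LInfD) (sigS : ℝ → ℝ → LInfD) (c : ℝ) : Prop where
  nonneg : ∀ ν ∈ nodes M, ∀ μ ∈ nodes M, ∀ᵐ x ∂(volume.restrict spaceD), 0 ≤ sigS ν μ x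
  le_left : ∀ μ ∈ nodes M, ∀ᵐ x ∂(volume.restrict spaceD),
    c ≤ sigT μ x - 1 / 2 * ∑ ν ∈ nodes M, weight M ν * sigS ν μ x
  le_right : ∀ ν ∈ nodes M, ∀ᵐ x ∂(volume.restrict spaceD),
    c ≤ sigT ν x - 1 / 2 * ∑ μ ∈ nodes M, weight M μ * sigS ν μ x

/-- A quadrature error of `c` enters with the factor 1/2 and so uses up half of the margin. -/
theorem ae_le_sub_sum {M : ℕ} {t : LInfD} {f : ℝ → LInfD} {c : ℝ}
    (h : ∀ᵐ x ∂(volume.restrict spaceD), c ≤ t x - 1 / 2 * (∫ ν in dirL, f ν : LInfD) x)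
    (hf : ‖∑ ν ∈ nodes M, weight M ν • f ν - ∫ ν in dirL, f ν‖ ≤ c) :
    ∀ᵐ x ∂(volume.restrict spaceD), c / 2 ≤ t x - 1 / 2 * ∑ ν ∈ nodes M, weight M ν * f ν x := by
  filter_upwards [h, ae_le_of_norm_sub_le hf, coeFn_sum_smul_ae (nodes M) (weight M) f]
    with x h1 h2 h3
  rw [h3] at h2
  linarith

/-- The Hölder constant is common to all frozen directions, so one threshold serves every node,
although the nodes themselves move with `M`. -/
theorem exists_nodalSubcritical {sigT : ℝ → LInfD} {sigS : ℝ → ℝ → LInfD} {c : ℝ}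
    (hsigS : MemH1H1 sigS)
    (hsigS_nonneg : ∀ ν ∈ dirL, ∀ μ ∈ dirL, ∀ᵐ x ∂(volume.restrict spaceD), 0 ≤ sigS ν μ x)
    (hc : 0 < c)
    (hsub₁ : ∀ μ ∈ dirL, ∀ᵐ x ∂(volume.restrict spaceD),
      c ≤ sigT μ x - 1 / 2 * (∫ ν in dirL, sigS ν μ : LInfD) x)
    (hsub₂ : ∀ ν ∈ dirL, ∀ᵐ x ∂(volume.restrict spaceD),
      c ≤ sigT ν x - 1 / 2 * (∫ μ in dirL, sigS ν μ : LInfD) x) :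
    ∃ M₀ : ℕ, ∀ M ≥ M₀, NodalSubcritical M sigT sigS (c / 2) := by
  obtain ⟨K, hK, h1, h2⟩ := hsigS.exists_halfHolder
  obtain ⟨M₀, hM₀⟩ := exists_quadrature_error_le LInfD hK hc
  refine ⟨M₀, fun M hM => ⟨fun ν hν μ hμ => hsigS_nonneg ν (nodes_subset hν) μ (nodes_subset hμ),
    fun μ hμ => ?_, fun ν hν => ?_⟩⟩
  · exact ae_le_sub_sum (hsub₁ μ (nodes_subset hμ)) (hM₀ M hM _ (h1 μ (nodes_subset hμ)))
  · exact ae_le_sub_sum (hsub₂ ν (nodes_subset hν)) (hM₀ M hM _ (h2 ν (nodes_subset hν)))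

theorem NodalSubcritical.coercive {M N : ℕ} {sigT : ℝ → LInfD} {sigS : ℝ → ℝ → LInfD} {c : ℝ}
    (h : NodalSubcritical M sigT sigS c) {φ : ℝ[X][Y]} (hφ : φ ∈ vacuumSpace M N) :
    c * tripleNorm (fun x μ => φ.evalEval x μ) ^ 2
        + 1 / 2 * ∑ μ ∈ nodes M, weight M μ * |μ| * (φ.evalEval (Real.sign μ) μ) ^ 2
      ≤ innerM M (opLM M sigT sigS φ) (fun x μ => φ.evalEval x μ) := by
  rw [tripleNorm_sq hφ.1]
  set p : ℝ → ℝ[X] := fun μ => φ.eval (C μ) with hp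
  set R : ℝ → ℝ → ℝ := fun μ x => sigT μ x * (p μ).eval x
    - 1 / 2 * ∑ ν ∈ nodes M, weight M ν * sigS ν μ x * (p ν).eval x with hR
  have hRi : ∀ μ, Integrable (R μ) (volume.restrict spaceD) := fun μ =>
    (integrable_mul_eval (integrable_LInfD _) _).sub (Integrable.const_mul
      (integrable_finsetSum _ fun ν _ =>
        integrable_mul_eval ((integrable_LInfD (sigS ν μ)).const_mul (weight M ν)) (p ν)) _)
  have hsplit : ∀ μ ∈ nodes M,
      innerD (fun x => opLM M sigT sigS φ x μ) (fun x => (p μ).eval x) =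
        1 / 2 * (|μ| * (p μ).eval (Real.sign μ) ^ 2) +
          innerD (R μ) (fun x => (p μ).eval x) := by
    intro μ hμ
    have e : (fun x => opLM M sigT sigS φ x μ) =
        fun x => μ * (derivative (p μ)).eval x + R μ x := by
      ext x
      simp only [opLM, hR, hp, evalEval]
      ring
    rw [e, innerD_add_left ((integrable_eval _).const_mul μ) (hRi μ), innerD_smul_left,
      innerD_eval, mul_polyInt_derivative (hφ.2 μ hμ)]
  have hmain : c * ∑ μ ∈ nodes M, weight M μ * polyInt (p μ * p μ) ≤
      ∑ μ ∈ nodes M, weight M μ * innerD (R μ) (fun x => (p μ).eval x) := by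
    have hl : c * ∑ μ ∈ nodes M, weight M μ * polyInt (p μ * p μ) =
        ∫ x in spaceD, c * ∑ μ ∈ nodes M, weight M μ * (p μ).eval x ^ 2 := by
      rw [integral_const_mul, integral_finsetSum]
      · congr 1
        refine Finset.sum_congr rfl fun μ _ => ?_
        rw [integral_const_mul, ← setIntegral_eval]
        simp only [eval_mul, sq]
      · intro μ _
        simpa [sq] using (integrable_eval (p μ * p μ)).const_mul (weight M μ)
    have hri : ∀ μ ∈ nodes M, Integrable (fun x => weight M μ * (R μ x * (p μ).eval x))
        (volume.restrict spaceD) := fun μ _ => (integrable_mul_eval (hRi μ) _).const_mul _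
    have hr : ∑ μ ∈ nodes M, weight M μ * innerD (R μ) (fun x => (p μ).eval x) =
        ∫ x in spaceD, ∑ μ ∈ nodes M, weight M μ * (R μ x * (p μ).eval x) := by
      rw [integral_finsetSum _ hri]
      exact Finset.sum_congr rfl fun μ _ => (integral_const_mul _ _).symm
    rw [hl, hr]
    refine integral_mono_ae (Integrable.const_mul (integrable_finsetSum _ fun μ _ => ?_) _)
      (integrable_finsetSum _ hri) ?_
    · simpa [sq] using (integrable_eval (p μ * p μ)).const_mul (weight M μ)
    -- There are finitely many nodes, so all nodal bounds hold at almost every `x` simultaneously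
    -- and the finite-dimensional inequality applies pointwise.
    have a1 := (ae_ball_iff (nodes M).countable_toSet).2 fun ν hν =>
      (ae_ball_iff (nodes M).countable_toSet).2 fun μ hμ => h.nonneg ν hν μ hμ
    have a2 := (ae_ball_iff (nodes M).countable_toSet).2 h.le_left
    have a3 := (ae_ball_iff (nodes M).countable_toSet).2 h.le_right
    filter_upwards [a1, a2, a3] with x b1 b2 b3
    exact sum_scattering_le (w := weight M) (T := fun μ => sigT μ x)
      (p := fun μ => (p μ).eval x) (σ := fun ν μ => sigS ν μ x)
      (fun i hi => (weight_pos hi).le) b1 b2 b3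
  have hM : innerM M (opLM M sigT sigS φ) (fun x μ => φ.evalEval x μ) =
      1 / 2 * ∑ μ ∈ nodes M, weight M μ * |μ| * (φ.evalEval (Real.sign μ) μ) ^ 2 +
        ∑ μ ∈ nodes M, weight M μ * innerD (R μ) (fun x => (p μ).eval x) := by
    rw [innerM, Finset.mul_sum, ← Finset.sum_add_distrib]
    refine Finset.sum_congr rfl fun μ hμ => ?_
    have h1 := hsplit μ hμ
    have h2 : innerD (fun x => opLM M sigT sigS φ x μ) (fun x => φ.evalEval x μ) =
      innerD (fun x => opLM M sigT sigS φ x μ) (fun x => (p μ).eval x) := rfl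
    have h3 : φ.evalEval (Real.sign μ) μ = (p μ).eval (Real.sign μ) := rfl
    rw [h2, h1, h3]
    ring
  rw [hM]
  linarith

end NeutronTransport

/-! ### Existence and uniqueness for the discrete problem. -/

namespace NeutronTransport

/-! ### Polynomials in `μ` with prescribed values at the nodes -/

/-- Lagrange interpolation in `μ` with coefficients in `ℝ[X]`. It makes the nodal values
independent, both for lifting inflow data and for building test functions living at one node. -/
theorem exists_trial_interpolant {M N : ℕ} (q : ℝ → ℝ[X]) (hq : ∀ μ ∈ nodes M, (q μ).natDegree ≤ N) :
    ∃ ψ ∈ trialSpace M N, ∀ μ ∈ nodes M, ψ.eval (C μ) = q μ := by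
  have hev : ∀ (m μ : ℝ), ((Lagrange.basis (nodes M) id m).map C).eval (C μ) =
      (C ((Lagrange.basis (nodes M) id m).eval μ) : ℝ[X]) := fun m μ => eval_map_apply C μ
  refine ⟨∑ m ∈ nodes M, C (q m) * (Lagrange.basis (nodes M) id m).map C, ⟨?_, fun j => ?_⟩,
    fun μ hμ => ?_⟩
  · refine natDegree_sum_le_of_forall_le _ _ fun m hm => ?_
    refine (natDegree_C_mul_le _ _).trans (natDegree_map_le.trans ?_)
    rw [natDegree_le_iff_degree_le, Lagrange.degree_basis (injOn_id _) hm, card_nodes]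
    simp
  · rw [finsetSum_coeff]
    refine natDegree_sum_le_of_forall_le _ _ fun m hm => ?_
    rw [coeff_C_mul, coeff_map]
    exact (natDegree_mul_C_le _ _).trans (hq m hm)
  · rw [eval_finsetSum, Finset.sum_eq_single_of_mem μ hμ]
    · have h1 := Lagrange.eval_basis_self (injOn_id (nodes M : Set ℝ)) hμ
      rw [id] at h1
      rw [eval_mul, eval_C, hev, h1, C_1, mul_one]
    · intro m _ hne
      have h1 : (Lagrange.basis (nodes M) id m).eval μ = 0 :=
        Lagrange.eval_basis_of_ne (v := id) hne hμ
      rw [eval_mul, hev, h1, C_0, mul_zero]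

theorem eq_zero_of_eval_nodes {M N : ℕ} {φ : ℝ[X][Y]} (hφ : φ ∈ trialSpace M N)
    (h : ∀ μ ∈ nodes M, φ.eval (C μ) = 0) : φ = 0 := by
  classical
  refine eq_zero_of_natDegree_lt_card_of_eval_eq_zero' φ ((nodes M).image C) ?_ ?_
  · simpa using h
  · rw [Finset.card_image_of_injective _ C_injective, card_nodes]
    exact Nat.lt_succ_iff.2 hφ.1

/-- The space of vacuum boundary conditions, as a subspace. -/
def vacuumSubmodule (M N : ℕ) : Submodule ℝ ℝ[X][Y] where
  carrier := vacuumSpace M N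
  zero_mem' := by simp [vacuumSpace, trialSpace, nodalSpace]
  add_mem' := by
    rintro φ ψ ⟨⟨h1, h2⟩, h3⟩ ⟨⟨g1, g2⟩, g3⟩
    refine ⟨⟨natDegree_add_le_of_degree_le h1 g1, fun j => ?_⟩, fun μ hμ => ?_⟩
    · rw [coeff_add]
      exact natDegree_add_le_of_degree_le (h2 j) (g2 j)
    · rw [eval_add]
      refine ⟨natDegree_add_le_of_degree_le (h3 μ hμ).1 (g3 μ hμ).1, fun h => ?_, fun h => ?_⟩
      · rw [eval_add, (h3 μ hμ).2.1 h, (g3 μ hμ).2.1 h, add_zero]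
      · rw [eval_add, (h3 μ hμ).2.2 h, (g3 μ hμ).2.2 h, add_zero]
  smul_mem' := by
    rintro a φ ⟨⟨h1, h2⟩, h3⟩
    refine ⟨⟨(natDegree_smul_le _ _).trans h1, fun j => ?_⟩, fun μ hμ => ?_⟩
    · rw [coeff_smul]
      exact (natDegree_smul_le _ _).trans (h2 j)
    · rw [eval_smul]
      refine ⟨(natDegree_smul_le _ _).trans (h3 μ hμ).1, fun h => ?_, fun h => ?_⟩
      · rw [eval_smul, (h3 μ hμ).2.1 h, smul_zero]
      · rw [eval_smul, (h3 μ hμ).2.2 h, smul_zero]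

instance finiteDimensional_vacuumSubmodule (M N : ℕ) :
    FiniteDimensional ℝ (vacuumSubmodule M N) := by
  let T : vacuumSubmodule M N →ₗ[ℝ] (Fin (M + 1) → Fin (N + 1) → ℝ) :=
    { toFun := fun φ i j => (φ.1.coeff i).coeff j
      map_add' := fun φ ψ => by ext i j; simp
      map_smul' := fun a φ => by ext i j; simp }
  refine Module.Finite.of_injective T fun φ ψ hφ => ?_
  obtain ⟨⟨h1, h2⟩, -⟩ := φ.2
  obtain ⟨⟨g1, g2⟩, -⟩ := ψ.2
  refine Subtype.ext (Polynomial.ext fun i => Polynomial.ext fun j => ?_)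
  by_cases hi : i ≤ M
  · by_cases hj : j ≤ N
    · exact congrFun (congrFun hφ ⟨i, Nat.lt_succ_iff.2 hi⟩) ⟨j, Nat.lt_succ_iff.2 hj⟩
    · rw [coeff_eq_zero_of_natDegree_lt ((h2 i).trans_lt (not_le.1 hj)),
        coeff_eq_zero_of_natDegree_lt ((g2 i).trans_lt (not_le.1 hj))]
  · rw [coeff_eq_zero_of_natDegree_lt (h1.trans_lt (not_le.1 hi)),
      coeff_eq_zero_of_natDegree_lt (g1.trans_lt (not_le.1 hi))]

/-! ### Solvability of the discrete problem -/

/-- A definite bilinear form on a finite-dimensional space represents every functional. -/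
theorem surjective_of_definite {E : Type*} [AddCommGroup E] [Module ℝ E] (V : Submodule ℝ E)
    [FiniteDimensional ℝ V] (B : V →ₗ[ℝ] Module.Dual ℝ V) (hB : ∀ φ, B φ φ = 0 → φ = 0) :
    Function.Surjective B :=
  (LinearMap.injective_iff_surjective_of_finrank_eq_finrank Subspace.dual_finrank_eq.symm).1 <|
    (injective_iff_map_eq_zero _).2 fun φ hφ => hB φ (by rw [hφ, LinearMap.zero_apply])

section Solvability

variable {M N : ℕ} {sigT : ℝ → LInfD} {sigS : ℝ → ℝ → LInfD} {c : ℝ}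

theorem NodalSubcritical.eq_zero (h : NodalSubcritical M sigT sigS c) (hc : 0 < c) {φ : ℝ[X][Y]}
    (hφ : φ ∈ vacuumSpace M N)
    (h0 : innerM M (opLM M sigT sigS φ) (fun x μ => φ.evalEval x μ) = 0) : φ = 0 := by
  have h1 := h.coercive hφ
  have h2 : 0 ≤ ∑ μ ∈ nodes M, weight M μ * |μ| * (φ.evalEval (Real.sign μ) μ) ^ 2 :=
    Finset.sum_nonneg fun μ hμ => mul_nonneg (mul_nonneg (weight_pos hμ).le (abs_nonneg μ))
      (sq_nonneg _)
  have h3 : tripleNorm (fun x μ => φ.evalEval x μ) ^ 2 = 0 := by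
    refine le_antisymm ?_ (sq_nonneg _)
    by_contra! h4
    have := mul_pos hc h4
    linarith
  rw [tripleNorm_sq hφ.1, Finset.sum_eq_zero_iff_of_nonneg fun μ hμ =>
    mul_nonneg (weight_pos hμ).le (polyInt_sq_nonneg _)] at h3
  refine eq_zero_of_eval_nodes hφ.1 fun μ hμ => polyInt_sq_eq_zero ?_
  exact (mul_eq_zero.1 (h3 μ hμ)).resolve_left (weight_pos hμ).ne'

variable (M N sigT sigS) in
/-- The discrete bilinear form on the space of vacuum boundary conditions. -/
noncomputable def discreteForm :
    vacuumSubmodule M N →ₗ[ℝ] Module.Dual ℝ (vacuumSubmodule M N) :=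
  LinearMap.mk₂ ℝ
    (fun φ ψ => ∑ μ ∈ nodes M, weight M μ *
      innerD (fun x => opLM M sigT sigS φ.1 x μ) (fun x => (ψ.1.eval (C μ)).eval x))
    (fun φ₁ φ₂ ψ => by
      rw [← Finset.sum_add_distrib]
      refine Finset.sum_congr rfl fun μ _ => ?_
      rw [Submodule.coe_add, innerD_opLM_add, mul_add])
    (fun a φ ψ => by
      rw [smul_eq_mul, Finset.mul_sum]
      refine Finset.sum_congr rfl fun μ _ => ?_
      rw [Submodule.coe_smul, innerD_opLM_smul]
      ring)
    (fun φ ψ₁ ψ₂ => by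
      rw [← Finset.sum_add_distrib]
      refine Finset.sum_congr rfl fun μ _ => ?_
      rw [Submodule.coe_add, eval_add, innerD_add_right (integrable_opLM M sigT sigS φ.1 μ),
        mul_add])
    (fun a φ ψ => by
      rw [smul_eq_mul, Finset.mul_sum]
      refine Finset.sum_congr rfl fun μ _ => ?_
      rw [Submodule.coe_smul, eval_smul, innerD_smul_right]
      ring)

variable (M N) in
/-- The functional on the space of vacuum boundary conditions given by nodal sources. -/
noncomputable def sourceFunctional (f : ℝ → ℝ → ℝ)
    (hf : ∀ μ, Integrable (f μ) (volume.restrict spaceD)) :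
    Module.Dual ℝ (vacuumSubmodule M N) where
  toFun ψ := ∑ μ ∈ nodes M, weight M μ * innerD (f μ) (fun x => (ψ.1.eval (C μ)).eval x)
  map_add' ψ₁ ψ₂ := by
    rw [← Finset.sum_add_distrib]
    refine Finset.sum_congr rfl fun μ _ => ?_
    rw [Submodule.coe_add, eval_add, innerD_add_right (hf μ), mul_add]
  map_smul' a ψ := by
    rw [RingHom.id_apply, smul_eq_mul, Finset.mul_sum]
    refine Finset.sum_congr rfl fun μ _ => ?_
    rw [Submodule.coe_smul, eval_smul, innerD_smul_right]
    ring

theorem zero_mem_nodalSpace (N : ℕ) (μ : ℝ) : (0 : ℝ[X]) ∈ nodalSpace N μ := by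
  simp [nodalSpace]

/-- Solvability of the problem with vacuum boundary conditions and arbitrary nodal sources. -/
theorem NodalSubcritical.exists_vacuum_solution (h : NodalSubcritical M sigT sigS c) (hc : 0 < c)
    (N : ℕ) (f : ℝ → ℝ → ℝ) (hf : ∀ μ, Integrable (f μ) (volume.restrict spaceD)) :
    ∃ φ ∈ vacuumSpace M N, ∀ μ ∈ nodes M, ∀ v ∈ nodalSpace N μ,
      innerD (fun x => opLM M sigT sigS φ x μ) (fun x => v.eval x) =
        innerD (f μ) (fun x => v.eval x) := by
  classical
  obtain ⟨φ, hφ⟩ := surjective_of_definite (vacuumSubmodule M N) (discreteForm M N sigT sigS)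
    (fun φ hφ => Subtype.ext (h.eq_zero hc φ.2 hφ)) (sourceFunctional M N f hf)
  refine ⟨φ.1, φ.2, fun μ hμ v hv => ?_⟩
  -- A test function equal to `v` at `μ` and zero at the other nodes isolates one equation of the
  -- weighted sum; its positive weight cancels.
  obtain ⟨ψ, hψ, hψv⟩ := exists_trial_interpolant (M := M) (N := N)
    (fun m => if m = μ then v else 0) (fun m _ => by
      split_ifs
      · exact hv.1
      · simp)
  have hψvac : ψ ∈ vacuumSpace M N := by
    refine ⟨hψ, fun m hm => ?_⟩
    rw [hψv m hm]
    split_ifs with hmμ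
    · rwa [hmμ]
    · exact zero_mem_nodalSpace N m
  have hsum : ∀ g : ℝ → ℝ → ℝ,
      ∑ m ∈ nodes M, weight M m * innerD (g m) (fun x => (ψ.eval (C m)).eval x) =
        weight M μ * innerD (g μ) (fun x => v.eval x) := by
    intro g
    rw [Finset.sum_eq_single_of_mem μ hμ]
    · rw [hψv μ hμ, if_pos rfl]
    · intro m hm hne
      rw [hψv m hm, if_neg hne, innerD_zero_right, mul_zero]
  have h1 := DFunLike.congr_fun hφ ⟨ψ, hψvac⟩
  have h2 : weight M μ * innerD (fun x => opLM M sigT sigS φ.1 x μ) (fun x => v.eval x) =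
      weight M μ * innerD (f μ) (fun x => v.eval x) := by
    rw [← hsum fun m x => opLM M sigT sigS φ.1 x m, ← hsum f]
    exact h1
  exact mul_left_cancel₀ (weight_pos hμ).ne' h2

theorem trialSpace_add {φ ψ : ℝ[X][Y]} (hφ : φ ∈ trialSpace M N) (hψ : ψ ∈ trialSpace M N) :
    φ + ψ ∈ trialSpace M N :=
  ⟨natDegree_add_le_of_degree_le hφ.1 hψ.1, fun j => by
    rw [coeff_add]
    exact natDegree_add_le_of_degree_le (hφ.2 j) (hψ.2 j)⟩

theorem trialSpace_sub {φ ψ : ℝ[X][Y]} (hφ : φ ∈ trialSpace M N) (hψ : ψ ∈ trialSpace M N) :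
    φ - ψ ∈ trialSpace M N :=
  ⟨natDegree_sub_le_of_le hφ.1 hψ.1 |>.trans (max_self M).le, fun j => by
    rw [coeff_sub]
    exact (natDegree_sub_le_of_le (hφ.2 j) (hψ.2 j)).trans (max_self N).le⟩

theorem natDegree_eval_C_le {φ : ℝ[X][Y]} (hφ : φ ∈ trialSpace M N) (μ : ℝ) :
    (φ.eval (C μ)).natDegree ≤ N := by
  rw [eval_eq_sum_range]
  refine natDegree_sum_le_of_forall_le _ _ fun j _ => ?_
  rw [← C_pow]
  exact (natDegree_mul_C_le _ _).trans (hφ.2 j)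

theorem NodalSubcritical.existsUnique_solution (h : NodalSubcritical M sigT sigS c) (hc : 0 < c)
    (N : ℕ) (s : ℝ → L2D) (gl gr : ℝ → ℝ) :
    ∃! φ : ℝ[X][Y], IsDiscreteSolution M N sigT sigS s gl gr φ := by
  refine existsUnique_of_exists_of_unique ?_ fun φ₁ φ₂ h₁ h₂ => ?_
  -- The lift is constant in `x` at each node, hence admissible even for `N = 0`. At `μ = 0` no
  -- condition is imposed, so the value chosen there is immaterial.
  · obtain ⟨φ₀, hφ₀, hg⟩ := exists_trial_interpolant (M := M) (N := N)
      (fun μ => C (if 0 < μ then gl μ else gr μ)) fun μ _ => by simp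
    have hs : ∀ μ, Integrable (s μ) (volume.restrict spaceD) := fun μ =>
      (Lp.memLp (s μ)).integrable (by norm_num)
    obtain ⟨ψ, hψ, hsol⟩ := h.exists_vacuum_solution hc N
      (fun μ x => 1 / 2 * s μ x + (-1) * opLM M sigT sigS φ₀ x μ) fun μ =>
        ((hs μ).const_mul _).add ((integrable_opLM M sigT sigS φ₀ μ).const_mul _)
    refine ⟨φ₀ + ψ, trialSpace_add hφ₀ hψ.1, fun μ hμ v hv => ?_, fun μ hμ hpos => ?_,
      fun μ hμ hneg => ?_⟩
    · rw [innerD_opLM_add, hsol μ hμ v hv, innerD_add_left ((hs μ).const_mul _)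
        ((integrable_opLM M sigT sigS φ₀ μ).const_mul _), innerD_smul_left, innerD_smul_left]
      ring
    · rw [evalEval, eval_add, eval_add, (hψ.2 μ hμ).2.1 hpos, hg μ hμ, if_pos hpos, eval_C,
        add_zero]
    · rw [evalEval, eval_add, eval_add, (hψ.2 μ hμ).2.2 hneg, hg μ hμ, if_neg hneg.not_gt, eval_C,
        add_zero]
  · rw [← sub_eq_zero]
    have hev : ∀ x μ, ((φ₁ - φ₂).eval (C μ)).eval x = φ₁.evalEval x μ - φ₂.evalEval x μ :=
      fun x μ => by rw [eval_sub, eval_sub]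
    have hvac : φ₁ - φ₂ ∈ vacuumSpace M N := by
      refine ⟨trialSpace_sub h₁.1 h₂.1, fun μ hμ =>
        ⟨natDegree_eval_C_le (trialSpace_sub h₁.1 h₂.1) μ, fun hpos => ?_, fun hneg => ?_⟩⟩
      · rw [hev, h₁.2.2.1 μ hμ hpos, h₂.2.2.1 μ hμ hpos, sub_self]
      · rw [hev, h₁.2.2.2 μ hμ hneg, h₂.2.2.2 μ hμ hneg, sub_self]
    refine h.eq_zero hc hvac (Finset.sum_eq_zero fun μ hμ => ?_)
    -- At each node the difference of two solutions is itself an admissible test function, so every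
    -- term of the discrete form vanishes.
    have h3 := innerD_opLM_add M sigT sigS (φ₁ - φ₂) φ₂ μ ((φ₁ - φ₂).eval (C μ))
    rw [sub_add_cancel, h₁.2.1 μ hμ _ (hvac.2 μ hμ), h₂.2.1 μ hμ _ (hvac.2 μ hμ)] at h3
    have h4 : innerD (fun x => opLM M sigT sigS (φ₁ - φ₂) x μ)
        (fun x => ((φ₁ - φ₂).eval (C μ)).eval x) = 0 := by linarith
    exact mul_eq_zero_of_right _ h4

end Solvability

end NeutronTransport

open NeutronTransport in
theorem theorem3p1
    (sigT : ℝ → LInfD) (sigS : ℝ → ℝ → LInfD) (c : ℝ)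
    (hsigT : ContinuousOn sigT dirL)
    (hsigS : MemH1H1 sigS)
    (hsigS_nonneg : ∀ ν ∈ dirL, ∀ μ ∈ dirL, ∀ᵐ x ∂(volume.restrict spaceD), 0 ≤ sigS ν μ x)
    (hc : 0 < c)
    (hsub₁ : ∀ μ ∈ dirL, ∀ᵐ x ∂(volume.restrict spaceD),
      c ≤ sigT μ x - 1 / 2 * (∫ ν in dirL, sigS ν μ : LInfD) x)
    (hsub₂ : ∀ ν ∈ dirL, ∀ᵐ x ∂(volume.restrict spaceD),
      c ≤ sigT ν x - 1 / 2 * (∫ μ in dirL, sigS ν μ : LInfD) x) :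
    ∃ M₀ : ℕ, ∀ M ≥ M₀, ∀ N : ℕ,
      (∀ (s : ℝ → L2D) (gl gr : ℝ → ℝ),
        ∃! φ : ℝ[X][Y], IsDiscreteSolution M N sigT sigS s gl gr φ) ∧
      (∀ φ ∈ vacuumSpace M N,
        c / 2 * tripleNorm (fun x μ => φ.evalEval x μ) ^ 2
          + 1 / 2 * ∑ μ ∈ nodes M, weight M μ * |μ| * (φ.evalEval (Real.sign μ) μ) ^ 2
        ≤ innerM M (opLM M sigT sigS φ) (fun x μ => φ.evalEval x μ)) := by
  obtain ⟨M₀, hM₀⟩ := exists_nodalSubcritical hsigS hsigS_nonneg hc hsub₁ hsub₂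
  exact ⟨M₀, fun M hM N =>
    ⟨fun s gl gr => (hM₀ M hM).existsUnique_solution (half_pos hc) N s gl gr,
      fun φ hφ => (hM₀ M hM).coercive hφ⟩⟩
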